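/- Let $G$ be a finite group. **Bisets.** For subgroups $H,K\le G$, a finite bifree $K$-$H$ biset is a finite set with commuting free actions of $K$ on the left and of $H$ on the right. The $G$-Burnside category $\mathbf A(G)$ has the subgroups of $G$ as objects; $\mathrm{Hom}_{\mathbf A(G)}(H,K)$ is the Grothendieck group of the monoid (under disjoint union) of isomorphism classes of finite bifree $K$-$H$ bisets; composition is induced by the balanced product $X\times_K Y$, and the identity of $H$ is the biset $H$. A bifree $K$-$H$ biset $X$ is a conjugation biset if for each $x\in X$ there is $g\in G$ such that $kx=xh$ (with $k\in K$, $h\in H$) implies $h=g^{-1}kg$. Let $\mathbf B(G)\subset\mathbf A(G)$ be the subcategory with the same objects whose morphism groups are generated by the conjugation bisets, and let $\mathbf B_\bullet(G)\subset\mathbf A_\bullet(G)$ be the additive completions, with objects the finite tuples of objects and morphisms the matrices of morphisms. Let $\tau$ be the contravariant involution of $\mathbf B(G)$ sending a $K$-$H$ biset $X$ to the $H$-$K$ biset $X$ with actions $h\cdot x\cdot k=k^{-1}xh^{-1}$, and $\tau_\bullet$ the induced contravariant involution of $\mathbf B_\bullet(G)$ (apply $\tau$ to each entry and transpose). **The functor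 $j$.** Let $\mathcal D(G)$ be the category of finite left $G$-sets and $G$-maps, and $\mathcal D_*(G)$ the category of finite $G$-sets with an ordered family of base points, one in each orbit, with all $G$-maps as morphisms. The forgetful functor $\mu\colon\mathcal D_*(G)\to\mathcal D(G)$ is an equivalence; let $\mu'$ be any inverse of it, i.e. any functor with $\mu\circ\mu'\cong\mathrm{id}$. Define a covariant functor $j_\bullet\colon\mathcal D_*(G)\to\mathbf B_\bullet(G)$ by sending $(X,(b_1,\dots,b_k))$ to the tuple of isotropy groups $(H_1,\dots,H_k)$, $H_i=G_{b_i}$, and sending a $G$-map $\varphi\colon (X,(b_i))\to (Y,(c_l))$, with $K_l=G_{c_l}$, to the matrix whose $(i,l)$ entry is the class of the $K_l$-$H_i$ biset $K_l$ (left multiplication by $K_l$, right action of $h\in H_i$ by right multiplication by $g^{-1}hg$) if $\varphi(b_i)=g c_l$ for some $g\in G$, and is $0$ otherwise. With the contravariant functor $j^\bullet=\tau_\bullet\circ j_\bullet$ this gives the bivariant functor $j=(j^\bullet,j_\bullet)\circ\mu'\colon\mathcal D(G)\to\mathbf B_\bullet(G)\subset\mathbf A_\bullet(G)$. **Mackey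 functors.** A bivariant functor $\mathcal M=(\mathcal M_*,\mathcal M^*)$ from $\mathcal D(G)$ to the category $\mathcal Ab$ of abelian groups (a covariant and a contravariant functor agreeing on objects) is a Mackey functor if (M1) for every pullback square of finite $G$-sets with $\Psi\colon S\to S_1$, $\Phi\colon S\to S_2$, $\varphi\colon S_1\to T$, $\psi\colon S_2\to T$ one has $\mathcal M^*(\varphi)\circ\mathcal M_*(\psi)=\mathcal M_*(\Psi)\circ\mathcal M^*(\Phi)$, and (M2) the embeddings of $S_1$ and $S_2$ into $S_1\sqcup S_2$ induce an isomorphism $\mathcal M^*(S_1\sqcup S_2)\to\mathcal M^*(S_1)\oplus\mathcal M^*(S_2)$, and $\mathcal M(\emptyset)=0$. **Corollary B.** For any additive functor $F\colon\mathbf A_\bullet(G)\to\mathcal Ab$, the composition $F\circ j\colon\mathcal D(G)\to\mathcal Ab$ is a Mackey functor. -/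

import Mathlib

open CategoryTheory

universe u v w u₁ v₁ u₂ v₂ u₃ v₃

noncomputable section

namespace MackeyBiset

/-! ### Bivariant functors -/

/-- A bivariant functor `C → D`: a covariant and a contravariant functor which agree on objects. -/
structure BivariantFunctor (C : Type u₁) [Category.{v₁} C] (D : Type u₂) [Category.{v₂} D] where
  /-- the common value of both functors on objects -/
  obj : C → D
  /-- the covariant (lower star) maps -/
  push : ∀ {X Y : C}, (X ⟶ Y) → (obj X ⟶ obj Y)
  /-- the contravariant (upper star) maps -/
  pull : ∀ {X Y : C}, (X ⟶ Y) → (obj Y ⟶ obj X)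
  push_id : ∀ X : C, push (𝟙 X) = 𝟙 (obj X)
  push_comp : ∀ {X Y Z : C} (f : X ⟶ Y) (g : Y ⟶ Z), push (f ≫ g) = push f ≫ push g
  pull_id : ∀ X : C, pull (𝟙 X) = 𝟙 (obj X)
  pull_comp : ∀ {X Y Z : C} (f : X ⟶ Y) (g : Y ⟶ Z), pull (f ≫ g) = pull g ≫ pull f

namespace BivariantFunctor

variable {C : Type u₁} [Category.{v₁} C] {D : Type u₂} [Category.{v₂} D]
  {E : Type u₃} [Category.{v₃} E]

/-- The composite `F ∘ M` of a bivariant functor `M` followed by a functor `F`. -/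
def postcomp (M : BivariantFunctor C D) (F : D ⥤ E) : BivariantFunctor C E where
  obj X := F.obj (M.obj X)
  push f := F.map (M.push f)
  pull f := F.map (M.pull f)
  push_id X := by rw [M.push_id, F.map_id]
  push_comp f g := by rw [M.push_comp, F.map_comp]
  pull_id X := by rw [M.pull_id, F.map_id]
  pull_comp f g := by rw [M.pull_comp, F.map_comp]

/-- The composite `M ∘ F` of a functor `F` followed by a bivariant functor `M`. -/
def precomp (F : E ⥤ C) (M : BivariantFunctor C D) : BivariantFunctor E D where
  obj X := M.obj (F.obj X)
  push f := M.push (F.map f)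
  pull f := M.pull (F.map f)
  push_id X := by rw [F.map_id, M.push_id]
  push_comp f g := by rw [F.map_comp, M.push_comp]
  pull_id X := by rw [F.map_id, M.pull_id]
  pull_comp f g := by rw [F.map_comp, M.pull_comp]

end BivariantFunctor

/-! ### The category of finite `G`-sets and Mackey functors -/

/-- A finite left `G`-set. -/
structure GSet (G : Type u) [Group G] where
  /-- the underlying set -/
  carrier : Type u
  [action : MulAction G carrier]
  [finite : Finite carrier]

attribute [instance] GSet.action GSet.finite

section GSet

variable (G : Type u) [Group G]

instance : CoeSort (GSet G) (Type u) := ⟨GSet.carrier⟩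

/-- The category `𝒟(G)` of finite left `G`-sets and `G`-maps. -/
instance : Category (GSet G) where
  Hom X Y := X →[G] Y
  id X := MulActionHom.id G
  comp f g := MulActionHom.comp g f

variable {G}

/-- The `G`-map underlying a morphism of `𝒟(G)`. -/
def GSet.toMap {X Y : GSet G} (φ : X ⟶ Y) : X →[G] Y := φ

lemma GSet.toMap_id (X : GSet G) (x : X) : GSet.toMap (𝟙 X) x = x := rfl

lemma GSet.toMap_comp {X Y Z : GSet G} (φ : X ⟶ Y) (ψ : Y ⟶ Z) (x : X) :
    GSet.toMap (φ ≫ ψ) x = GSet.toMap ψ (GSet.toMap φ x) := rfl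

/-- The disjoint union of two finite `G`-sets. -/
def GSet.sum (X Y : GSet G) : GSet G := ⟨X ⊕ Y⟩

/-- The embedding of the first summand. -/
def GSet.inl (X Y : GSet G) : X ⟶ X.sum Y :=
  ({ toFun := Sum.inl, map_smul' := fun _ _ => rfl } : X →[G] (X ⊕ Y))

/-- The embedding of the second summand. -/
def GSet.inr (X Y : GSet G) : Y ⟶ X.sum Y :=
  ({ toFun := Sum.inr, map_smul' := fun _ _ => rfl } : Y →[G] (X ⊕ Y))

/-- A bivariant functor from finite `G`-sets to abelian groups is a Mackey functor if it satisfies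
the pull-back axiom (M1) and the additivity axiom (M2). -/
structure IsMackey (M : BivariantFunctor (GSet G) AddCommGrpCat.{w}) : Prop where
  /-- (M1) -/
  pull_push : ∀ {S S₁ S₂ T : GSet G} {Ψ : S ⟶ S₁} {Φ : S ⟶ S₂} {φ : S₁ ⟶ T} {ψ : S₂ ⟶ T},
    IsPullback Ψ Φ φ ψ → M.push ψ ≫ M.pull φ = M.pull Φ ≫ M.push Ψ
  /-- (M2) on a disjoint union -/
  additive : ∀ S₁ S₂ : GSet G, Function.Bijective
    (AddMonoidHom.prod (M.pull (GSet.inl S₁ S₂)).hom (M.pull (GSet.inr S₁ S₂)).hom)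
  /-- (M2) on the empty set -/
  empty : ∀ S : GSet G, IsEmpty S → Subsingleton (M.obj S)

end GSet

/-! ### Bifree bisets -/

/-- A finite bifree `K`-`H` biset: a finite set with commuting free actions of `K` on the left and
of `H` on the right. The right action is written as a left action of the opposite group. -/
structure Biset (K H : Type u) [Group K] [Group H] where
  /-- the underlying set -/
  carrier : Type u
  [left : MulAction K carrier]
  [right : MulAction Hᵐᵒᵖ carrier]
  [comm : SMulCommClass K Hᵐᵒᵖ carrier]
  [finite : Finite carrier]
  left_free : ∀ (k : K) (x : carrier), k • x = x → k = 1
  right_free : ∀ (h : H) (x : carrier), MulOpposite.op h • x = x → h = 1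

attribute [instance] Biset.left Biset.right Biset.comm Biset.finite

namespace Biset

variable {K H L J : Type u} [Group K] [Group H] [Group L] [Group J]

instance : CoeSort (Biset K H) (Type u) := ⟨Biset.carrier⟩

/-- The right action `x · h`. -/
def rsmul {X : Biset K H} (x : X) (h : H) : X := MulOpposite.op h • x

lemma rsmul_one {X : Biset K H} (x : X) : rsmul x 1 = x := one_smul _ x

lemma rsmul_mul {X : Biset K H} (x : X) (h h' : H) : rsmul x (h * h') = rsmul (rsmul x h) h' := by
  simp [rsmul, mul_smul]

lemma smul_rsmul {X : Biset K H} (k : K) (x : X) (h : H) :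
    k • rsmul x h = rsmul (k • x) h := smul_comm k (MulOpposite.op h) x

/-- An isomorphism of `K`-`H` bisets. -/
structure Iso (X Y : Biset K H) where
  /-- the underlying bijection -/
  toEquiv : X ≃ Y
  map_smul : ∀ (k : K) (x : X), toEquiv (k • x) = k • toEquiv x
  map_rsmul : ∀ (x : X) (h : H), toEquiv (rsmul x h) = rsmul (toEquiv x) h

/-- The identity isomorphism. -/
def Iso.refl (X : Biset K H) : Iso X X := ⟨Equiv.refl _, fun _ _ => rfl, fun _ _ => rfl⟩

/-- The inverse isomorphism. -/
def Iso.symm {X Y : Biset K H} (e : Iso X Y) : Iso Y X where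
  toEquiv := e.toEquiv.symm
  map_smul k y := by rw [Equiv.symm_apply_eq, e.map_smul, Equiv.apply_symm_apply]
  map_rsmul y h := by rw [Equiv.symm_apply_eq, e.map_rsmul, Equiv.apply_symm_apply]

/-- The composite isomorphism. -/
def Iso.trans {X Y Z : Biset K H} (e : Iso X Y) (f : Iso Y Z) : Iso X Z where
  toEquiv := e.toEquiv.trans f.toEquiv
  map_smul k x := by simp [e.map_smul, f.map_smul]
  map_rsmul x h := by simp [e.map_rsmul, f.map_rsmul]

variable (K H) in
instance isoSetoid : Setoid (Biset K H) where
  r X Y := Nonempty (Iso X Y)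
  iseqv := ⟨fun X => ⟨Iso.refl X⟩, fun ⟨e⟩ => ⟨e.symm⟩, fun ⟨e⟩ ⟨f⟩ => ⟨e.trans f⟩⟩

variable (K H) in
/-- The empty biset. -/
def empty : Biset K H where
  carrier := PEmpty
  left := { smul := fun _ x => x, one_smul := fun _ => rfl, mul_smul := fun _ _ _ => rfl }
  right := { smul := fun _ x => x, one_smul := fun _ => rfl, mul_smul := fun _ _ _ => rfl }
  comm := @SMulCommClass.mk _ _ _ (_) (_) fun _ _ x => x.elim
  left_free _ x := x.elim
  right_free _ x := x.elim

/-- The disjoint union of bisets. -/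
def sum (X Y : Biset K H) : Biset K H where
  carrier := X ⊕ Y
  left_free := by
    rintro k (x | y) h
    · exact X.left_free k x (Sum.inl_injective h)
    · exact Y.left_free k y (Sum.inr_injective h)
  right_free := by
    rintro k (x | y) h
    · exact X.right_free k x (Sum.inl_injective h)
    · exact Y.right_free k y (Sum.inr_injective h)

lemma rsmul_inl {X Y : Biset K H} (x : X) (h : H) :
    rsmul (X := sum X Y) (Sum.inl x) h = Sum.inl (rsmul x h) := rfl

lemma rsmul_inr {X Y : Biset K H} (y : Y) (h : H) :
    rsmul (X := sum X Y) (Sum.inr y) h = Sum.inr (rsmul y h) := rfl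

/-- The identity biset: `H` with left and right multiplication. -/
def one (H : Type u) [Group H] [Finite H] : Biset H H where
  carrier := H
  left_free k x h := by simpa using h
  right_free k x h := by simpa using h

/-- The conjugate transpose of a biset: the same set with `h · x · k = k⁻¹ x h⁻¹`. -/
def transpose (X : Biset K H) : Biset H K where
  carrier := X
  left :=
    { smul := fun h x => rsmul x h⁻¹
      one_smul := fun x => by
        change rsmul x (1 : H)⁻¹ = x
        rw [inv_one, rsmul_one]
      mul_smul := fun a b x => by
        change rsmul x (a * b)⁻¹ = rsmul (rsmul x b⁻¹) a⁻¹
        rw [mul_inv_rev, rsmul_mul] }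
  right :=
    { smul := fun k x => k.unop⁻¹ • x
      one_smul := fun x => by
        change (1 : K)⁻¹ • x = x
        simp
      mul_smul := fun a b x => by
        change (b.unop * a.unop)⁻¹ • x = a.unop⁻¹ • b.unop⁻¹ • x
        rw [mul_inv_rev, mul_smul] }
  comm := @SMulCommClass.mk _ _ _ (_) (_) fun h k x => (smul_rsmul k.unop⁻¹ x h⁻¹).symm
  left_free h x e := by simpa using X.right_free h⁻¹ x e
  right_free k x e := by simpa using X.left_free k⁻¹ x e

/-- The equivalence relation `(x h, y) ~ (x, h y)` defining the balanced product. -/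
def compSetoid (X : Biset L K) (Y : Biset K H) : Setoid (X × Y) where
  r p q := ∃ k : K, q.1 = rsmul p.1 k ∧ p.2 = k • q.2
  iseqv :=
    { refl := fun p => ⟨1, (rsmul_one _).symm, (one_smul _ _).symm⟩
      symm := by
        rintro p q ⟨k, h₁, h₂⟩
        exact ⟨k⁻¹, by rw [h₁, ← rsmul_mul, mul_inv_cancel, rsmul_one],
          by rw [h₂, inv_smul_smul]⟩
      trans := by
        rintro p q r ⟨k, h₁, h₂⟩ ⟨k', h₃, h₄⟩
        exact ⟨k * k', by rw [h₃, h₁, rsmul_mul], by rw [h₂, h₄, mul_smul]⟩ }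

/-- The balanced product `X ×_K Y`. -/
def comp (X : Biset L K) (Y : Biset K H) : Biset L H where
  carrier := Quotient (compSetoid X Y)
  left :=
    { smul := fun l => Quotient.map' (s₁ := compSetoid X Y) (s₂ := compSetoid X Y)
        (fun p => (l • p.1, p.2))
        (by rintro p q ⟨k, h₁, h₂⟩; exact ⟨k, by simp only [h₁, smul_rsmul], h₂⟩)
      one_smul := by
        rintro ⟨p⟩
        exact congrArg (Quotient.mk (compSetoid X Y)) (Prod.ext (one_smul _ _) rfl)
      mul_smul := by
        rintro a b ⟨p⟩
        exact congrArg (Quotient.mk (compSetoid X Y)) (Prod.ext (mul_smul _ _ _) rfl) }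
  right :=
    { smul := fun h => Quotient.map' (s₁ := compSetoid X Y) (s₂ := compSetoid X Y)
        (fun p => (p.1, h • p.2))
        (by rintro p q ⟨k, h₁, h₂⟩; exact ⟨k, h₁, by simp only [h₂, smul_comm k h]⟩)
      one_smul := by
        rintro ⟨p⟩
        exact congrArg (Quotient.mk (compSetoid X Y)) (Prod.ext rfl (one_smul _ _))
      mul_smul := by
        rintro a b ⟨p⟩
        exact congrArg (Quotient.mk (compSetoid X Y)) (Prod.ext rfl (mul_smul _ _ _)) }
  comm := @SMulCommClass.mk _ _ _ (_) (_) (by rintro l h ⟨p⟩; rfl)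
  finite := Quotient.finite _
  left_free := by
    rintro l ⟨p⟩ e
    obtain ⟨k, h₁, h₂⟩ := Quotient.exact e
    have hk : k = 1 := Y.left_free k p.2 h₂.symm
    subst hk
    rw [rsmul_one] at h₁
    exact X.left_free l p.1 h₁.symm
  right_free := by
    rintro h ⟨p⟩ e
    obtain ⟨k, h₁, h₂⟩ := Quotient.exact e
    have hk : k = 1 := X.right_free k p.1 h₁.symm
    subst hk
    rw [one_smul] at h₂
    exact Y.right_free h p.2 h₂

/-- The class of `(x, y)` in the balanced product. -/
def pair {X : Biset L K} {Y : Biset K H} (x : X) (y : Y) : comp X Y :=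
  Quotient.mk (compSetoid X Y) (x, y)

lemma pair_surj {X : Biset L K} {Y : Biset K H} (z : comp X Y) : ∃ x y, z = pair x y := by
  obtain ⟨p, rfl⟩ := Quotient.exists_rep z
  exact ⟨p.1, p.2, rfl⟩

lemma smul_pair {X : Biset L K} {Y : Biset K H} (l : L) (x : X) (y : Y) :
    l • pair x y = pair (l • x) y := rfl

lemma pair_rsmul' {X : Biset L K} {Y : Biset K H} (x : X) (y : Y) (h : H) :
    rsmul (pair x y) h = pair x (rsmul y h) := rfl

lemma pair_eq_iff {X : Biset L K} {Y : Biset K H} {x x' : X} {y y' : Y} :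
    pair x y = pair x' y' ↔ ∃ k : K, x' = rsmul x k ∧ y = k • y' :=
  ⟨fun e => Quotient.exact e, fun e => Quotient.sound (s := compSetoid X Y) e⟩

lemma pair_balance {X : Biset L K} {Y : Biset K H} (x : X) (k : K) (y : Y) :
    pair (rsmul x k) y = pair x (k • y) := (pair_eq_iff.2 ⟨k, rfl, rfl⟩).symm

/-- A map out of a balanced product. -/
def compLift {X : Biset L K} {Y : Biset K H} {Z : Type u} (f : X → Y → Z)
    (hf : ∀ x k y, f (rsmul x k) y = f x (k • y)) : comp X Y → Z :=
  Quotient.lift (s := compSetoid X Y) (fun p => f p.1 p.2) (by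
    rintro ⟨x, y⟩ ⟨x', y'⟩ ⟨k, h₁, h₂⟩
    simp only at h₁ h₂
    subst h₁ h₂
    exact (hf x k y').symm)

lemma compLift_pair {X : Biset L K} {Y : Biset K H} {Z : Type u} (f : X → Y → Z)
    (hf : ∀ x k y, f (rsmul x k) y = f x (k • y)) (x : X) (y : Y) :
    compLift f hf (pair x y) = f x y := rfl

/-- An equivariant bijection is an isomorphism of bisets. -/
lemma equiv_of_bijective {X Y : Biset K H} (f : X → Y) (hf : Function.Bijective f)
    (h₁ : ∀ (k : K) x, f (k • x) = k • f x) (h₂ : ∀ x (h : H), f (rsmul x h) = rsmul (f x) h) :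
    X ≈ Y := ⟨⟨Equiv.ofBijective f hf, h₁, h₂⟩⟩

lemma comp_congr {X X' : Biset L K} {Y Y' : Biset K H} (hX : X ≈ X') (hY : Y ≈ Y') :
    comp X Y ≈ comp X' Y' := by
  obtain ⟨e⟩ := hX
  obtain ⟨f⟩ := hY
  refine equiv_of_bijective
    (compLift (fun x y => pair (e.toEquiv x) (f.toEquiv y)) fun x k y => by
      rw [e.map_rsmul, f.map_smul, pair_balance]) ⟨?_, ?_⟩ ?_ ?_
  · intro z z' h
    obtain ⟨x, y, rfl⟩ := pair_surj z
    obtain ⟨x', y', rfl⟩ := pair_surj z'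
    obtain ⟨k, h₁, h₂⟩ := pair_eq_iff.1 h
    rw [← e.map_rsmul] at h₁
    rw [← f.map_smul] at h₂
    exact pair_eq_iff.2 ⟨k, e.toEquiv.injective h₁, f.toEquiv.injective h₂⟩
  · intro z
    obtain ⟨x, y, rfl⟩ := pair_surj z
    exact ⟨pair (e.toEquiv.symm x) (f.toEquiv.symm y), by simp [compLift_pair]⟩
  · intro l z
    obtain ⟨x, y, rfl⟩ := pair_surj z
    simp [compLift_pair, smul_pair, e.map_smul]
  · intro z h
    obtain ⟨x, y, rfl⟩ := pair_surj z
    simp [compLift_pair, pair_rsmul', f.map_rsmul]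

lemma sum_congr {X X' Y Y' : Biset K H} (hX : X ≈ X') (hY : Y ≈ Y') : sum X Y ≈ sum X' Y' := by
  obtain ⟨e⟩ := hX
  obtain ⟨f⟩ := hY
  refine ⟨⟨Equiv.sumCongr e.toEquiv f.toEquiv, ?_, ?_⟩⟩
  · rintro k (x | y)
    · exact congrArg Sum.inl (e.map_smul k x)
    · exact congrArg Sum.inr (f.map_smul k y)
  · rintro (x | y) h
    · exact congrArg Sum.inl (e.map_rsmul x h)
    · exact congrArg Sum.inr (f.map_rsmul y h)

lemma sum_comm (X Y : Biset K H) : sum X Y ≈ sum Y X :=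
  ⟨⟨Equiv.sumComm X Y, by rintro k (x | y) <;> rfl, by rintro (x | y) h <;> rfl⟩⟩

lemma sum_assoc (X Y Z : Biset K H) : sum (sum X Y) Z ≈ sum X (sum Y Z) :=
  ⟨⟨Equiv.sumAssoc X Y Z, by rintro k ((x | y) | z) <;> rfl, by rintro ((x | y) | z) h <;> rfl⟩⟩

lemma empty_sum (X : Biset K H) : sum (empty K H) X ≈ X :=
  ⟨⟨Equiv.emptySum PEmpty X, by rintro k (x | y); exacts [x.elim, rfl],
    by rintro (x | y) h; exacts [x.elim, rfl]⟩⟩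

lemma equiv_empty (X : Biset K H) [IsEmpty X] : X ≈ empty K H :=
  ⟨⟨Equiv.equivPEmpty X, fun _ x => isEmptyElim x, fun x _ => isEmptyElim x⟩⟩

lemma empty_comp (Y : Biset K H) : comp (empty L K) Y ≈ empty L H := by
  have : IsEmpty (comp (empty L K) Y) :=
    ⟨fun z => by obtain ⟨x, -, -⟩ := pair_surj z; exact PEmpty.elim x⟩
  exact equiv_empty _

lemma comp_empty (X : Biset L K) : comp X (empty K H) ≈ empty L H := by
  have : IsEmpty (comp X (empty K H)) :=
    ⟨fun z => by obtain ⟨-, x, -⟩ := pair_surj z; exact PEmpty.elim x⟩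
  exact equiv_empty _

lemma sum_comp (X X' : Biset L K) (Y : Biset K H) :
    comp (sum X X') Y ≈ sum (comp X Y) (comp X' Y) := by
  refine Setoid.symm (equiv_of_bijective
    (Sum.elim (compLift (fun x y => pair (X := sum X X') (Sum.inl x) y) ?_)
      (compLift (fun x y => pair (X := sum X X') (Sum.inr x) y) ?_)) ⟨?_, ?_⟩ ?_ ?_)
  · intro x k y
    exact pair_balance (X := sum X X') (Sum.inl x) k y
  · intro x k y
    exact pair_balance (X := sum X X') (Sum.inr x) k y
  · rintro (z | z) (z' | z') h <;> obtain ⟨x, y, rfl⟩ := pair_surj z <;>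
      obtain ⟨x', y', rfl⟩ := pair_surj z' <;>
      obtain ⟨k, h₁, h₂⟩ := pair_eq_iff.1 h
    · exact congrArg Sum.inl (pair_eq_iff.2 ⟨k, Sum.inl_injective h₁, h₂⟩)
    · cases h₁
    · cases h₁
    · exact congrArg Sum.inr (pair_eq_iff.2 ⟨k, Sum.inr_injective h₁, h₂⟩)
  · intro z
    obtain ⟨x | x, y, rfl⟩ := pair_surj z
    · exact ⟨Sum.inl (pair x y), rfl⟩
    · exact ⟨Sum.inr (pair x y), rfl⟩
  · rintro l (z | z) <;> obtain ⟨x, y, rfl⟩ := pair_surj z <;> rfl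
  · rintro (z | z) h <;> obtain ⟨x, y, rfl⟩ := pair_surj z <;> rfl

lemma comp_sum (X : Biset L K) (Y Y' : Biset K H) :
    comp X (sum Y Y') ≈ sum (comp X Y) (comp X Y') := by
  refine Setoid.symm (equiv_of_bijective
    (Sum.elim (compLift (fun x y => pair (Y := sum Y Y') x (Sum.inl y)) ?_)
      (compLift (fun x y => pair (Y := sum Y Y') x (Sum.inr y)) ?_)) ⟨?_, ?_⟩ ?_ ?_)
  · intro x k y
    exact pair_balance (Y := sum Y Y') x k (Sum.inl y)
  · intro x k y
    exact pair_balance (Y := sum Y Y') x k (Sum.inr y)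
  · rintro (z | z) (z' | z') h <;> obtain ⟨x, y, rfl⟩ := pair_surj z <;>
      obtain ⟨x', y', rfl⟩ := pair_surj z' <;>
      obtain ⟨k, h₁, h₂⟩ := pair_eq_iff.1 h
    · exact congrArg Sum.inl (pair_eq_iff.2 ⟨k, h₁, Sum.inl_injective h₂⟩)
    · cases h₂
    · cases h₂
    · exact congrArg Sum.inr (pair_eq_iff.2 ⟨k, h₁, Sum.inr_injective h₂⟩)
  · intro z
    obtain ⟨x, y | y, rfl⟩ := pair_surj z
    · exact ⟨Sum.inl (pair x y), rfl⟩
    · exact ⟨Sum.inr (pair x y), rfl⟩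
  · rintro l (z | z) <;> obtain ⟨x, y, rfl⟩ := pair_surj z <;> rfl
  · rintro (z | z) h <;> obtain ⟨x, y, rfl⟩ := pair_surj z <;> rfl

lemma comp_assoc (X : Biset L K) (Y : Biset K H) (Z : Biset H J) :
    comp (comp X Y) Z ≈ comp X (comp Y Z) := by
  refine equiv_of_bijective
    (compLift (fun p z => compLift (fun x y => pair x (pair y z)) (fun x k y => by
      rw [pair_balance, smul_pair]) p) ?_) ⟨?_, ?_⟩ ?_ ?_
  · intro p h z
    obtain ⟨x, y, rfl⟩ := pair_surj p
    simp only [pair_rsmul', compLift_pair, pair_balance]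
  · intro a b e
    obtain ⟨p, z, rfl⟩ := pair_surj a
    obtain ⟨x, y, rfl⟩ := pair_surj p
    obtain ⟨p', z', rfl⟩ := pair_surj b
    obtain ⟨x', y', rfl⟩ := pair_surj p'
    simp only [compLift_pair] at e
    obtain ⟨k, h₁, h₂⟩ := pair_eq_iff.1 e
    rw [smul_pair] at h₂
    obtain ⟨h, h₃, h₄⟩ := pair_eq_iff.1 h₂
    refine pair_eq_iff.2 ⟨h, ?_, h₄⟩
    rw [pair_rsmul']
    exact (pair_eq_iff.2 ⟨k, h₁, h₃.symm⟩).symm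
  · intro a
    obtain ⟨x, p, rfl⟩ := pair_surj a
    obtain ⟨y, z, rfl⟩ := pair_surj p
    exact ⟨pair (pair x y) z, rfl⟩
  · intro l a
    obtain ⟨p, z, rfl⟩ := pair_surj a
    obtain ⟨x, y, rfl⟩ := pair_surj p
    rfl
  · intro a h
    obtain ⟨p, z, rfl⟩ := pair_surj a
    obtain ⟨x, y, rfl⟩ := pair_surj p
    rfl

lemma one_comp [Finite K] (X : Biset K H) : comp (one K) X ≈ X := by
  refine equiv_of_bijective (compLift (fun (k : K) x => k • x) ?_) ⟨?_, ?_⟩ ?_ ?_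
  · intro a k x
    exact mul_smul (show K from a) k x
  · intro a b e
    obtain ⟨k, x, rfl⟩ := pair_surj a
    obtain ⟨k', x', rfl⟩ := pair_surj b
    change (show K from k) • x = (show K from k') • x' at e
    refine pair_eq_iff.2 ⟨(show K from k)⁻¹ * (show K from k'), ?_, ?_⟩
    · exact (mul_inv_cancel_left (show K from k) (show K from k')).symm
    · rw [mul_smul, ← e, inv_smul_smul]
  · intro x
    exact ⟨pair (X := one K) (1 : K) x, one_smul K x⟩
  · intro l a
    obtain ⟨k, x, rfl⟩ := pair_surj a
    exact mul_smul l (show K from k) x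
  · intro a h
    obtain ⟨k, x, rfl⟩ := pair_surj a
    exact smul_rsmul (show K from k) x h

lemma comp_one [Finite H] (X : Biset K H) : comp X (one H) ≈ X := by
  refine equiv_of_bijective (compLift (fun x (h : H) => rsmul x h) ?_) ⟨?_, ?_⟩ ?_ ?_
  · intro x k a
    exact (rsmul_mul x k (show H from a)).symm
  · intro a b e
    obtain ⟨x, h, rfl⟩ := pair_surj a
    obtain ⟨x', h', rfl⟩ := pair_surj b
    change rsmul x (show H from h) = rsmul x' (show H from h') at e
    refine pair_eq_iff.2 ⟨(show H from h) * (show H from h')⁻¹, ?_, ?_⟩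
    · rw [rsmul_mul, e, ← rsmul_mul, mul_inv_cancel, rsmul_one]
    · exact (inv_mul_cancel_right (show H from h) (show H from h')).symm
  · intro x
    exact ⟨pair (Y := one H) x (1 : H), rsmul_one x⟩
  · intro l a
    obtain ⟨x, h, rfl⟩ := pair_surj a
    exact (smul_rsmul l x (show H from h)).symm
  · intro a h
    obtain ⟨x, h', rfl⟩ := pair_surj a
    exact rsmul_mul x (show H from h') h

lemma transpose_congr {X Y : Biset K H} (h : X ≈ Y) : transpose X ≈ transpose Y := by
  obtain ⟨e⟩ := h
  exact ⟨⟨e.toEquiv, fun k x => e.map_rsmul x k⁻¹, fun x h => e.map_smul h⁻¹ x⟩⟩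

lemma transpose_empty : transpose (empty K H) ≈ empty H K :=
  ⟨⟨Equiv.refl _, fun _ x => PEmpty.elim x, fun x _ => PEmpty.elim x⟩⟩

lemma transpose_sum (X Y : Biset K H) : transpose (sum X Y) ≈ sum (transpose X) (transpose Y) :=
  ⟨⟨Equiv.refl _, by rintro k (x | y) <;> rfl, by rintro (x | y) h <;> rfl⟩⟩

lemma transpose_one [Finite H] : transpose (one H) ≈ one H := by
  refine ⟨⟨Equiv.inv H, fun k x => ?_, fun x k => ?_⟩⟩
  · exact (mul_inv_rev (show H from x) k⁻¹).trans
      (congrArg (· * (show H from x)⁻¹) (inv_inv k))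
  · exact (mul_inv_rev k⁻¹ (show H from x)).trans
      (congrArg ((show H from x)⁻¹ * ·) (inv_inv k))

lemma rsmul_rsmul_inv (X : Biset K H) (x : X) (h : H) : rsmul (rsmul x h) h⁻¹ = x := by
  rw [← rsmul_mul, mul_inv_cancel, rsmul_one]

lemma transpose_comp (X : Biset L K) (Y : Biset K H) :
    transpose (comp X Y) ≈ comp (transpose Y) (transpose X) := by
  refine Setoid.symm (equiv_of_bijective (Y := transpose (comp X Y))
    (compLift (X := transpose Y) (Y := transpose X) (fun y x => pair (X := X) (Y := Y) x y) ?_)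
    ⟨?_, ?_⟩ ?_ ?_)
  · intro y k x
    exact (pair_balance (X := X) (Y := Y) x k⁻¹ y).symm
  · intro a b e
    obtain ⟨y, x, rfl⟩ := pair_surj a
    obtain ⟨y', x', rfl⟩ := pair_surj b
    obtain ⟨k, h₁, h₂⟩ := (pair_eq_iff (X := X) (Y := Y)).1 e
    refine pair_eq_iff.2 ⟨k, ?_, ?_⟩
    · exact (inv_smul_eq_iff (α := Y).2 h₂).symm
    · exact ((congrArg (fun z => rsmul (X := X) z k⁻¹) h₁).trans
        (rsmul_rsmul_inv X x k)).symm
  · intro a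
    obtain ⟨x, y, rfl⟩ := pair_surj (X := X) (Y := Y) a
    exact ⟨pair (X := transpose Y) (Y := transpose X) y x, rfl⟩
  · intro l a
    obtain ⟨y, x, rfl⟩ := pair_surj a
    rfl
  · intro a l
    obtain ⟨y, x, rfl⟩ := pair_surj a
    rfl

end Biset

/-! ### Isomorphism classes of bisets -/

/-- The set of isomorphism classes of finite bifree `K`-`H` bisets. -/
def BisetClass (K H : Type u) [Group K] [Group H] : Type (u + 1) :=
  Quotient (Biset.isoSetoid K H)

namespace BisetClass

variable {K H L J : Type u} [Group K] [Group H] [Group L] [Group J]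

/-- The isomorphism class of a biset. -/
def mk (X : Biset K H) : BisetClass K H := Quotient.mk _ X

lemma mk_eq {X Y : Biset K H} (h : X ≈ Y) : mk X = mk Y := Quotient.sound h

instance : Add (BisetClass K H) :=
  ⟨Quotient.map₂ Biset.sum fun _ _ h _ _ h' => Biset.sum_congr h h'⟩

instance : Zero (BisetClass K H) := ⟨mk (Biset.empty K H)⟩

lemma mk_sum (X Y : Biset K H) : mk (Biset.sum X Y) = mk X + mk Y := rfl

lemma mk_empty : mk (Biset.empty K H) = 0 := rfl

lemma exists_rep (x : BisetClass K H) : ∃ X, x = mk X := by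
  obtain ⟨X, rfl⟩ := Quotient.exists_rep x
  exact ⟨X, rfl⟩

/-- Isomorphism classes form a commutative monoid under disjoint union. -/
instance : AddCommMonoid (BisetClass K H) where
  add_assoc := by
    rintro ⟨X⟩ ⟨Y⟩ ⟨Z⟩
    exact mk_eq (Biset.sum_assoc X Y Z)
  zero_add := by
    rintro ⟨X⟩
    exact mk_eq (Biset.empty_sum X)
  add_zero := by
    rintro ⟨X⟩
    exact mk_eq (Setoid.trans (Biset.sum_comm _ _) (Biset.empty_sum X))
  add_comm := by
    rintro ⟨X⟩ ⟨Y⟩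
    exact mk_eq (Biset.sum_comm X Y)
  nsmul := nsmulRec

/-- Balanced product on isomorphism classes. -/
def comp : BisetClass L K → BisetClass K H → BisetClass L H :=
  Quotient.map₂ Biset.comp fun _ _ h _ _ h' => Biset.comp_congr h h'

lemma mk_comp (X : Biset L K) (Y : Biset K H) : comp (mk X) (mk Y) = mk (Biset.comp X Y) := rfl

/-- Balanced product on isomorphism classes, as a biadditive map. -/
def compHom : BisetClass L K →+ BisetClass K H →+ BisetClass L H where
  toFun x :=
    { toFun := comp x
      map_zero' := by
        obtain ⟨X, rfl⟩ := exists_rep x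
        exact mk_eq (Biset.comp_empty X)
      map_add' := fun y y' => by
        obtain ⟨X, rfl⟩ := exists_rep x
        obtain ⟨Y, rfl⟩ := exists_rep y
        obtain ⟨Y', rfl⟩ := exists_rep y'
        exact mk_eq (Biset.comp_sum X Y Y') }
  map_zero' := by
    ext y
    obtain ⟨Y, rfl⟩ := exists_rep y
    exact mk_eq (Biset.empty_comp Y)
  map_add' x x' := by
    ext y
    obtain ⟨X, rfl⟩ := exists_rep x
    obtain ⟨X', rfl⟩ := exists_rep x'
    obtain ⟨Y, rfl⟩ := exists_rep y
    exact mk_eq (Biset.sum_comp X X' Y)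

lemma compHom_mk (X : Biset L K) (Y : Biset K H) :
    compHom (mk X) (mk Y) = mk (Biset.comp X Y) := rfl

/-- Conjugate transpose on isomorphism classes, as an additive map. -/
def transposeHom : BisetClass K H →+ BisetClass H K where
  toFun := Quotient.map Biset.transpose fun _ _ h => Biset.transpose_congr h
  map_zero' := mk_eq Biset.transpose_empty
  map_add' x y := by
    obtain ⟨X, rfl⟩ := exists_rep x
    obtain ⟨Y, rfl⟩ := exists_rep y
    exact mk_eq (Biset.transpose_sum X Y)

lemma transposeHom_mk (X : Biset K H) : transposeHom (mk X) = mk (Biset.transpose X) := rfl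

end BisetClass

/-! ### The Grothendieck group of finite bifree bisets -/

/-- The Grothendieck group of the monoid of isomorphism classes of finite bifree `K`-`H` bisets. -/
abbrev BisetGroup (K H : Type u) [Group K] [Group H] : Type (u + 1) :=
  Algebra.GrothendieckAddGroup (BisetClass K H)

namespace BisetGroup

variable {K H L J : Type u} [Group K] [Group H] [Group L] [Group J]

/-- The class of a biset in the Grothendieck group. -/
def cls (X : Biset K H) : BisetGroup K H := Algebra.GrothendieckAddGroup.of (BisetClass.mk X)

lemma cls_eq {X Y : Biset K H} (h : X ≈ Y) : cls X = cls Y :=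
  congrArg Algebra.GrothendieckAddGroup.of (BisetClass.mk_eq h)

lemma cls_sum (X Y : Biset K H) : cls (Biset.sum X Y) = cls X + cls Y := by
  rw [cls, BisetClass.mk_sum, map_add]; rfl

lemma cls_empty : cls (Biset.empty K H) = 0 := by
  rw [cls, BisetClass.mk_empty, map_zero]

/-- Additive maps out of the Grothendieck group are determined on bisets. -/
lemma hom_ext {A : Type v} [AddCommGroup A] {f g : BisetGroup K H →+ A}
    (h : ∀ X, f (cls X) = g (cls X)) : f = g := by
  apply Algebra.GrothendieckAddGroup.lift.symm.injective
  ext x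
  obtain ⟨X, rfl⟩ := BisetClass.exists_rep x
  exact h X

lemma lift_cls {A : Type v} [AddCommGroup A] (f : BisetClass K H →+ A) (X : Biset K H) :
    Algebra.GrothendieckAddGroup.lift f (cls X) = f (BisetClass.mk X) :=
  DFunLike.congr_fun (Algebra.GrothendieckAddGroup.lift.symm_apply_apply f) (BisetClass.mk X)

/-- Composition: the biadditive extension of the balanced product. -/
def compHom : BisetGroup L K →+ BisetGroup K H →+ BisetGroup L H :=
  Algebra.GrothendieckAddGroup.lift
    { toFun := fun x => Algebra.GrothendieckAddGroup.lift
        (Algebra.GrothendieckAddGroup.of.comp (BisetClass.compHom x))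
      map_zero' := by
        apply hom_ext
        intro X
        simp [lift_cls]
      map_add' := fun x y => by
        apply hom_ext
        intro X
        simp [lift_cls] }

lemma compHom_cls (X : Biset L K) (Y : Biset K H) :
    compHom (cls X) (cls Y) = cls (Biset.comp X Y) := by
  simp only [compHom, lift_cls, AddMonoidHom.coe_mk, ZeroHom.coe_mk]
  rfl

/-- Every element of the Grothendieck group is a difference of classes of bisets. -/
lemma induction {p : BisetGroup K H → Prop} (h : ∀ X, p (cls X))
    (hsub : ∀ x y, p x → p y → p (x - y)) (x : BisetGroup K H) : p x := by
  induction x using AddLocalization.ind with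
  | H m =>
    obtain ⟨a, b, hb⟩ := m
    obtain ⟨A, rfl⟩ := BisetClass.exists_rep a
    obtain ⟨B, rfl⟩ := BisetClass.exists_rep b
    have e : AddLocalization.mk (BisetClass.mk A) ⟨BisetClass.mk B, hb⟩ = cls A - cls B := by
      rw [eq_sub_iff_add_eq, AddLocalization.mk_eq_addMonoidOf_mk']
      exact AddSubmonoid.LocalizationMap.mk'_spec _ _ _
    rw [e]
    exact hsub _ _ (h A) (h B)

lemma compHom_assoc (x : BisetGroup L K) (y : BisetGroup K H) (z : BisetGroup H J) :
    compHom (compHom x y) z = compHom x (compHom y z) := by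
  induction x using induction with
  | hsub x x' hx hx' => simp only [map_sub, AddMonoidHom.sub_apply, hx, hx']
  | h X =>
    induction y using induction with
    | hsub y y' hy hy' => simp only [map_sub, AddMonoidHom.sub_apply, hy, hy']
    | h Y =>
      induction z using induction with
      | hsub z z' hz hz' => simp only [map_sub, hz, hz']
      | h Z =>
        simp only [compHom_cls]
        exact cls_eq (Biset.comp_assoc X Y Z)

lemma one_compHom [Finite K] (x : BisetGroup K H) : compHom (cls (Biset.one K)) x = x := by
  induction x using induction with
  | hsub x x' hx hx' => simp only [map_sub, hx, hx']
  | h X => rw [compHom_cls, cls_eq (Biset.one_comp X)]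

lemma compHom_one [Finite H] (x : BisetGroup K H) : compHom x (cls (Biset.one H)) = x := by
  induction x using induction with
  | hsub x x' hx hx' => simp only [map_sub, AddMonoidHom.sub_apply, hx, hx']
  | h X => rw [compHom_cls, cls_eq (Biset.comp_one X)]

/-- The conjugate transpose `τ` on the Grothendieck group. -/
def tau : BisetGroup K H →+ BisetGroup H K :=
  Algebra.GrothendieckAddGroup.lift
    (Algebra.GrothendieckAddGroup.of.comp BisetClass.transposeHom)

lemma tau_cls (X : Biset K H) : tau (cls X) = cls (Biset.transpose X) := by
  rw [tau, lift_cls]; rfl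

lemma tau_compHom (x : BisetGroup L K) (y : BisetGroup K H) :
    tau (compHom x y) = compHom (tau y) (tau x) := by
  induction x using induction with
  | hsub x x' hx hx' => simp only [map_sub, AddMonoidHom.sub_apply, hx, hx']
  | h X =>
    induction y using induction with
    | hsub y y' hy hy' => simp only [map_sub, AddMonoidHom.sub_apply, hy, hy']
    | h Y =>
      simp only [compHom_cls, tau_cls]
      exact cls_eq (Biset.transpose_comp X Y)

end BisetGroup

/-! ### The `G`-Burnside category and its subcategory of conjugation bisets -/

/-- The objects of the `G`-Burnside category `𝐀(G)`: the subgroups of `G`. -/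
structure Burnside (G : Type u) [Group G] where
  /-- the underlying subgroup -/
  subgroup : Subgroup G

section Burnside

variable {G : Type u} [Group G]

/-- The `G`-Burnside category `𝐀(G)`: a morphism `H ⟶ K` is an element of the Grothendieck group of
finite bifree `K`-`H` bisets, and composition is the balanced product. -/
instance [Finite G] : Category (Burnside G) where
  Hom H K := BisetGroup K.subgroup H.subgroup
  id H := BisetGroup.cls (Biset.one H.subgroup)
  comp f g := BisetGroup.compHom g f
  id_comp f := BisetGroup.compHom_one f
  comp_id f := BisetGroup.one_compHom f
  assoc f g h := (BisetGroup.compHom_assoc h g f).symm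

instance [Finite G] : Preadditive (Burnside G) where
  homGroup H K := inferInstanceAs (AddCommGroup (BisetGroup K.subgroup H.subgroup))
  add_comp H K L (f f' : BisetGroup K.subgroup H.subgroup)
      (g : BisetGroup L.subgroup K.subgroup) := map_add (BisetGroup.compHom g) f f'
  comp_add H K L (f : BisetGroup K.subgroup H.subgroup)
      (g g' : BisetGroup L.subgroup K.subgroup) :=
    DFunLike.congr_fun (map_add BisetGroup.compHom g g') f

/-- A `K`-`H` biset, for subgroups `K`, `H` of `G`, is a conjugation biset if at each point `x` the
isomorphism `k ↦ h` defined by `k x = x h` (between a subgroup of `K` and a subgroup of `H`) is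
`k ↦ g⁻¹ k g` for some `g ∈ G`. -/
def Biset.IsConjugation {K H : Subgroup G} (X : Biset K H) : Prop :=
  ∀ x : X, ∃ g : G, ∀ (k : K) (h : H), k • x = rsmul x h → (h : G) = g⁻¹ * k * g

lemma Biset.IsConjugation.one (H : Subgroup G) [Finite H] : (Biset.one H).IsConjugation := by
  intro (x : H)
  refine ⟨(x : G), fun k h e => ?_⟩
  have e' : (k : G) * x = x * h := congrArg Subtype.val e
  rw [mul_assoc, e', inv_mul_cancel_left]

lemma Biset.IsConjugation.comp {L K H : Subgroup G} {X : Biset L K} {Y : Biset K H}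
    (hX : X.IsConjugation) (hY : Y.IsConjugation) : (Biset.comp X Y).IsConjugation := by
  intro z
  obtain ⟨x, y, rfl⟩ := pair_surj z
  obtain ⟨a, ha⟩ := hX x
  obtain ⟨b, hb⟩ := hY y
  refine ⟨a * b, fun l h e => ?_⟩
  rw [smul_pair, pair_rsmul'] at e
  obtain ⟨k, h₁, h₂⟩ := pair_eq_iff.1 e.symm
  rw [hb k h h₂.symm, ha l k h₁]
  group

lemma Biset.IsConjugation.transpose {K H : Subgroup G} {X : Biset K H}
    (hX : X.IsConjugation) : (Biset.transpose X).IsConjugation := by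
  intro x
  obtain ⟨a, ha⟩ := hX x
  refine ⟨a⁻¹, fun h k e => ?_⟩
  have e' : rsmul (X := X) x h⁻¹ = k⁻¹ • (show X from x) := e
  have := ha k⁻¹ h⁻¹ e'.symm
  simp only [Subgroup.coe_inv] at this
  rw [inv_eq_iff_eq_inv.1 this]
  group

/-- The subgroup of the Grothendieck group generated by the conjugation bisets. -/
def conjSubgroup (K H : Subgroup G) : AddSubgroup (BisetGroup K H) :=
  AddSubgroup.closure {x | ∃ X : Biset K H, X.IsConjugation ∧ x = BisetGroup.cls X}

lemma cls_mem_conjSubgroup {K H : Subgroup G} {X : Biset K H} (hX : X.IsConjugation) :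
    BisetGroup.cls X ∈ conjSubgroup K H := AddSubgroup.subset_closure ⟨X, hX, rfl⟩

lemma compHom_mem_conjSubgroup {L K H : Subgroup G} {x : BisetGroup L K} {y : BisetGroup K H}
    (hx : x ∈ conjSubgroup L K) (hy : y ∈ conjSubgroup K H) :
    BisetGroup.compHom x y ∈ conjSubgroup L H := by
  induction hx using AddSubgroup.closure_induction with
  | zero => rw [map_zero]; exact zero_mem _
  | add x x' _ _ h h' => rw [map_add]; exact add_mem h h'
  | neg x _ h => rw [map_neg]; exact neg_mem h
  | mem x hx =>
    obtain ⟨X, hX, rfl⟩ := hx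
    induction hy using AddSubgroup.closure_induction with
    | zero => rw [map_zero]; exact zero_mem _
    | add x x' _ _ h h' => rw [map_add]; exact add_mem h h'
    | neg x _ h => rw [map_neg]; exact neg_mem h
    | mem y hy =>
      obtain ⟨Y, hY, rfl⟩ := hy
      rw [BisetGroup.compHom_cls]
      exact cls_mem_conjSubgroup (hX.comp hY)

lemma tau_mem_conjSubgroup {K H : Subgroup G} {x : BisetGroup K H}
    (hx : x ∈ conjSubgroup K H) : BisetGroup.tau x ∈ conjSubgroup H K := by
  induction hx using AddSubgroup.closure_induction with
  | zero => rw [map_zero]; exact zero_mem _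
  | add x x' _ _ h h' => rw [map_add]; exact add_mem h h'
  | neg x _ h => rw [map_neg]; exact neg_mem h
  | mem x hx =>
    obtain ⟨X, hX, rfl⟩ := hx
    rw [BisetGroup.tau_cls]
    exact cls_mem_conjSubgroup hX.transpose

/-- The objects of the conjugation biset category `𝐁(G)`: the subgroups of `G`. -/
structure ConjBurnside (G : Type u) [Group G] where
  /-- the underlying subgroup -/
  subgroup : Subgroup G

/-- The subcategory `𝐁(G)` of `𝐀(G)` with all objects, and with the morphisms generated by the
conjugation bisets: the differences of classes of conjugation bisets. -/
instance [Finite G] : Category (ConjBurnside G) where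
  Hom H K := conjSubgroup K.subgroup H.subgroup
  id H := ⟨BisetGroup.cls (Biset.one H.subgroup), cls_mem_conjSubgroup (.one _)⟩
  comp f g := ⟨BisetGroup.compHom g.1 f.1, compHom_mem_conjSubgroup g.2 f.2⟩
  id_comp f := Subtype.ext (BisetGroup.compHom_one f.1)
  comp_id f := Subtype.ext (BisetGroup.one_compHom f.1)
  assoc f g h := Subtype.ext (BisetGroup.compHom_assoc h.1 g.1 f.1).symm

instance [Finite G] : Preadditive (ConjBurnside G) where
  homGroup H K := inferInstanceAs (AddCommGroup (conjSubgroup K.subgroup H.subgroup))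
  add_comp _ _ _ f f' g := Subtype.ext (map_add (BisetGroup.compHom g.1) f.1 f'.1)
  comp_add _ _ _ f g g' :=
    Subtype.ext (DFunLike.congr_fun (map_add BisetGroup.compHom g.1 g'.1) f.1)

variable (G) in
/-- The inclusion of `𝐁(G)` in `𝐀(G)`. -/
def conjInclusion [Finite G] : ConjBurnside G ⥤ Burnside G where
  obj H := ⟨H.subgroup⟩
  map f := f.1
  map_id _ := rfl
  map_comp _ _ := rfl

instance [Finite G] : (conjInclusion G).Additive where
  map_add := rfl

variable (G) in
/-- The additive completion `𝐀_•(G)`, with objects the finite families of objects of `𝐀(G)` and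
with morphisms the matrices of morphisms. -/
abbrev BurnsideAdd [Finite G] := Mat_ (Burnside G)

variable (G) in
/-- The additive completion `𝐁_•(G)` of `𝐁(G)`. -/
abbrev ConjBurnsideAdd [Finite G] := Mat_ (ConjBurnside G)

variable (G) in
/-- The inclusion of `𝐁_•(G)` in `𝐀_•(G)`. -/
def conjInclusionAdd [Finite G] : ConjBurnsideAdd G ⥤ BurnsideAdd G :=
  (conjInclusion G).mapMat_

variable [Finite G]

/-- The contravariant involution `τ` of `𝐁(G)` on morphisms. -/
def tauB {H K : ConjBurnside G} : (H ⟶ K) →+ (K ⟶ H) :=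
  AddMonoidHom.mk' (fun f : conjSubgroup K.subgroup H.subgroup =>
    (⟨BisetGroup.tau f.1, tau_mem_conjSubgroup f.2⟩ : conjSubgroup H.subgroup K.subgroup))
    fun f g => Subtype.ext (map_add BisetGroup.tau f.1 g.1)

lemma tauB_id (H : ConjBurnside G) : tauB (𝟙 H) = 𝟙 H :=
  Subtype.ext ((BisetGroup.tau_cls _).trans (BisetGroup.cls_eq Biset.transpose_one))

lemma tauB_comp {H K L : ConjBurnside G} (f : H ⟶ K) (g : K ⟶ L) :
    tauB (f ≫ g) = tauB g ≫ tauB f :=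
  Subtype.ext (BisetGroup.tau_compHom g.1 f.1)

/-- The contravariant involution `τ_•` of `𝐁_•(G)` on morphisms: apply `τ` to each entry and
transpose the matrix. -/
def conjTranspose {M N : ConjBurnsideAdd G} (f : M ⟶ N) : N ⟶ M := fun i j => tauB (f j i)

lemma conjTranspose_id (M : ConjBurnsideAdd G) : conjTranspose (𝟙 M) = 𝟙 M := by
  refine Mat_.hom_ext _ _ fun i j => ?_
  change tauB ((𝟙 M : M ⟶ M) j i) = (𝟙 M : M ⟶ M) i j
  by_cases h : i = j
  · subst h
    rw [Mat_.id_apply_self, tauB_id]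
  · rw [Mat_.id_apply_of_ne _ _ _ h, Mat_.id_apply_of_ne _ _ _ (Ne.symm h), map_zero]

lemma conjTranspose_comp {M N P : ConjBurnsideAdd G} (f : M ⟶ N) (g : N ⟶ P) :
    conjTranspose (f ≫ g) = conjTranspose g ≫ conjTranspose f := by
  refine Mat_.hom_ext _ _ fun i j => ?_
  change tauB ((f ≫ g) j i) = (conjTranspose g ≫ conjTranspose f) i j
  rw [Mat_.comp_apply, Mat_.comp_apply, map_sum]
  exact Finset.sum_congr rfl fun k _ => tauB_comp _ _

/-! ### The bisets of maps between orbits -/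

/-- For `g ∈ G` with `g⁻¹ H g ⊆ K`, the biset `K`, with `K` acting on the left by multiplication and
`H` acting on the right through `h ↦ g⁻¹ h g`. It is associated with the `G`-map `G/H → G/K` given
by `eH ↦ gK`. -/
def twist (K H : Subgroup G) (g : G) (hg : ∀ h ∈ H, g⁻¹ * h * g ∈ K) : Biset K H where
  carrier := K
  right :=
    { smul := fun h x => (show K from x) * ⟨g⁻¹ * h.unop * g, hg _ h.unop.2⟩
      one_smul := fun x => Subtype.ext (by
        change (x : G) * (g⁻¹ * 1 * g) = x
        group)
      mul_smul := fun a b x => Subtype.ext (by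
        change (x : G) * (g⁻¹ * (b.unop * a.unop) * g) =
          (x : G) * (g⁻¹ * b.unop * g) * (g⁻¹ * a.unop * g)
        group) }
  comm := @SMulCommClass.mk _ _ _ (_) (_) fun k _ x => (mul_assoc k x _).symm
  left_free k x e := mul_eq_right.1 (show k * (show K from x) = (show K from x) from e)
  right_free h x e := by
    have e' : (x : G) * (g⁻¹ * h * g) = x := congrArg Subtype.val e
    rw [mul_eq_left] at e'
    apply Subtype.ext
    have : (h : G) = g * (g⁻¹ * h * g) * g⁻¹ := by group
    rw [this, e']
    simp

lemma twist_isConjugation (K H : Subgroup G) (g : G) (hg : ∀ h ∈ H, g⁻¹ * h * g ∈ K) :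
    (twist K H g hg).IsConjugation := by
  intro (x : K)
  refine ⟨(x : G) * g⁻¹, fun k h e => ?_⟩
  have e' : (k : G) * x = x * (g⁻¹ * h * g) := congrArg Subtype.val e
  have : (k : G) = x * (g⁻¹ * h * g) * (x : G)⁻¹ := by rw [← e', mul_inv_cancel_right]
  rw [this]
  group

/-- The biset only depends on the coset `g K`. -/
lemma twist_congr {K H : Subgroup G} {g g' : G} {hg : ∀ h ∈ H, g⁻¹ * h * g ∈ K}
    {hg' : ∀ h ∈ H, g'⁻¹ * h * g' ∈ K} (h : g⁻¹ * g' ∈ K) :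
    twist K H g hg ≈ twist K H g' hg' := by
  refine ⟨⟨(Equiv.mulRight (⟨g⁻¹ * g', h⟩ : K) : K ≃ K), fun k (x : K) => mul_assoc k x _,
    fun (x : K) a => ?_⟩⟩
  refine Subtype.ext ?_
  change (x : G) * (g⁻¹ * a * g) * (g⁻¹ * g') = (x : G) * (g⁻¹ * g') * (g'⁻¹ * a * g')
  group

lemma twist_one {H : Subgroup G} {hg : ∀ h ∈ H, (1 : G)⁻¹ * h * 1 ∈ H} :
    twist H H 1 hg ≈ Biset.one H := by
  refine ⟨⟨Equiv.refl H, fun k x => rfl, fun (x : H) a => Subtype.ext ?_⟩⟩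
  change (x : G) * (1⁻¹ * a * 1) = x * a
  group

lemma twist_comp {L K H : Subgroup G} {g g' : G} {hg : ∀ h ∈ H, g⁻¹ * h * g ∈ K}
    {hg' : ∀ k ∈ K, g'⁻¹ * k * g' ∈ L} {hgg' : ∀ h ∈ H, (g * g')⁻¹ * h * (g * g') ∈ L} :
    Biset.comp (twist L K g' hg') (twist K H g hg) ≈ twist L H (g * g') hgg' := by
  refine Biset.equiv_of_bijective (Biset.compLift (Z := L) (fun (x : L) (y : K) =>
    x * ⟨g'⁻¹ * y * g', hg' _ y.2⟩) ?_) ⟨?_, ?_⟩ ?_ ?_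
  · intro (x : L) k (y : K)
    refine Subtype.ext ?_
    change (x : G) * (g'⁻¹ * k * g') * (g'⁻¹ * y * g') = x * (g'⁻¹ * (k * y) * g')
    group
  · intro a b e
    obtain ⟨x, y, rfl⟩ := Biset.pair_surj a
    obtain ⟨x', y', rfl⟩ := Biset.pair_surj b
    have e' : ((show L from x : L) : G) * (g'⁻¹ * (show K from y : K) * g') =
      (show L from x' : L) * (g'⁻¹ * (show K from y' : K) * g') := congrArg Subtype.val e
    refine Biset.pair_eq_iff.2 ⟨(show K from y) * (show K from y')⁻¹, Subtype.ext ?_,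
      (inv_mul_cancel_right (show K from y) (show K from y')).symm⟩
    change ((show L from x' : L) : G) = ((show L from x : L) : G) *
      (g'⁻¹ * ((show K from y : K) * ((show K from y' : K) : G)⁻¹) * g')
    rw [← mul_inv_eq_iff_eq_mul] at e'
    rw [← e']
    group
  · intro x
    refine ⟨Biset.pair (X := twist L K g' hg') (Y := twist K H g hg) x (1 : K), Subtype.ext ?_⟩
    change ((show L from x : L) : G) * (g'⁻¹ * 1 * g') = (show L from x : L)
    group
  · intro l a
    obtain ⟨x, y, rfl⟩ := Biset.pair_surj a
    exact mul_assoc l (show L from x) _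
  · intro a h
    obtain ⟨x, y, rfl⟩ := Biset.pair_surj a
    refine Subtype.ext ?_
    change ((show L from x : L) : G) * (g'⁻¹ * ((show K from y : K) * (g⁻¹ * h * g)) * g') =
      (show L from x : L) * (g'⁻¹ * (show K from y : K) * g') * ((g * g')⁻¹ * h * (g * g'))
    group

end Burnside

/-! ### The bivariant functor `j` -/

/-- A finite `G`-set with an ordered collection of base points, one for each orbit. -/
structure PtGSet (G : Type u) [Group G] where
  /-- the underlying finite `G`-set -/
  toGSet : GSet G
  /-- the number of orbits -/
  n : ℕ
  /-- the base points -/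
  base : Fin n → toGSet
  existsUnique_base : ∀ x : toGSet, ∃! i, x ∈ MulAction.orbit G (base i)

namespace PtGSet

variable {G : Type u} [Group G]

/-- The category `𝒟_*(G)`: morphisms are all `G`-maps of the underlying `G`-sets. -/
instance : Category (PtGSet G) where
  Hom X Y := X.toGSet ⟶ Y.toGSet
  id X := 𝟙 X.toGSet
  comp f g := CategoryStruct.comp (obj := GSet G) f g

variable (G) in
/-- The functor `μ` from `𝒟_*(G)` to `𝒟(G)` forgetting the base points. -/
def forget : PtGSet G ⥤ GSet G where
  obj X := X.toGSet
  map f := f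

instance : (forget G).Full := ⟨fun f => ⟨f, rfl⟩⟩

instance : (forget G).Faithful := ⟨fun h => h⟩

/-- Every finite `G`-set admits base points. -/
lemma exists_pointed (X : GSet G) : ∃ P : PtGSet G, P.toGSet = X := by
  let Q := MulAction.orbitRel.Quotient G X
  have : Finite Q := Quotient.finite _
  obtain ⟨n, ⟨e⟩⟩ := Finite.exists_equiv_fin Q
  refine ⟨⟨X, n, fun i => (e.symm i).out, fun x => ⟨e (Quotient.mk'' x), ?_, ?_⟩⟩, rfl⟩
  · simp only [Equiv.symm_apply_apply]
    exact MulAction.orbitRel_apply.1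
      ((MulAction.orbitRel G X).symm (Quotient.mk_out (s := MulAction.orbitRel G X) x))
  · intro i hi
    have h : (Quotient.mk'' x : Q) = Quotient.mk'' (e.symm i).out :=
      Quotient.sound (MulAction.orbitRel_apply.2 hi)
    rw [h, Quotient.out_eq', Equiv.apply_symm_apply]

instance : (forget G).EssSurj :=
  ⟨fun X => by
    obtain ⟨P, rfl⟩ := exists_pointed X
    exact ⟨P, ⟨CategoryTheory.Iso.refl _⟩⟩⟩

/-- Forgetting the base points is an equivalence of categories. -/
instance : (forget G).IsEquivalence where

lemma base_unique (P : PtGSet G) {i j : Fin P.n} {g : G} (h : P.base i = g • P.base j) : i = j :=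
  (P.existsUnique_base (P.base i)).unique (MulAction.mem_orbit_self _) ⟨g, h.symm⟩

end PtGSet

section j

variable {G : Type u} [Group G]

lemma conj_mem_stabilizer {X Y : GSet G} (φ : X ⟶ Y) {x : X} {y : Y} {g : G}
    (hg : GSet.toMap φ x = g • y) :
    ∀ h ∈ MulAction.stabilizer G x, g⁻¹ * h * g ∈ MulAction.stabilizer G y := by
  intro h hh
  rw [MulAction.mem_stabilizer_iff] at hh ⊢
  rw [mul_smul, ← hg, mul_smul, ← map_smul, hh, hg, inv_smul_smul]

variable [Finite G]

/-- The object of `𝐁(G)` given by the isotropy group of a point. -/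
def stab {X : GSet G} (x : X) : ConjBurnside G := ⟨MulAction.stabilizer G x⟩

open Classical in
/-- Let `φ : X → Y` be a `G`-map and let `x : X` and `y : Y` have isotropy groups `H` and `K`. If
`φ x = g y`, so that `φ` restricts to the `G`-map `G/H → G/K` with `eH ↦ gK` between the orbits of
`x` and `y`, this is the class of the biset `K` on which `H` acts through `h ↦ g⁻¹ h g`. If `φ x`
is not in the orbit of `y`, it is zero. -/
def entry {X Y : GSet G} (φ : X ⟶ Y) (x : X) (y : Y) : stab x ⟶ stab y :=
  if hg : ∃ g : G, GSet.toMap φ x = g • y then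
    (⟨BisetGroup.cls (twist _ _ hg.choose (conj_mem_stabilizer φ hg.choose_spec)),
      cls_mem_conjSubgroup (twist_isConjugation _ _ _ _)⟩ :
      conjSubgroup (stab y).subgroup (stab x).subgroup)
  else 0

lemma entry_eq {X Y : GSet G} (φ : X ⟶ Y) {x : X} {y : Y} {g : G}
    (hg : GSet.toMap φ x = g • y) :
    entry φ x y = (⟨BisetGroup.cls (twist _ _ g (conj_mem_stabilizer φ hg)),
      cls_mem_conjSubgroup (twist_isConjugation _ _ _ _)⟩ :
      conjSubgroup (stab y).subgroup (stab x).subgroup) := by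
  have h : ∃ g : G, GSet.toMap φ x = g • y := ⟨g, hg⟩
  rw [entry, dif_pos h]
  refine Subtype.ext (BisetGroup.cls_eq (twist_congr ?_))
  change h.choose⁻¹ * g ∈ MulAction.stabilizer G y
  rw [MulAction.mem_stabilizer_iff, mul_smul, ← hg, inv_smul_eq_iff]
  exact h.choose_spec

lemma entry_eq_zero {X Y : GSet G} (φ : X ⟶ Y) {x : X} {y : Y}
    (h : ¬ ∃ g : G, GSet.toMap φ x = g • y) : entry φ x y = 0 := dif_neg h

lemma entry_id {X : GSet G} (x : X) : entry (𝟙 X) x x = 𝟙 (stab x) := by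
  rw [entry_eq (𝟙 X) (g := 1) (one_smul G x).symm]
  exact Subtype.ext (BisetGroup.cls_eq twist_one)

lemma entry_comp {X Y Z : GSet G} (φ : X ⟶ Y) (ψ : Y ⟶ Z) {x : X} {y : Y} {g : G} (z : Z)
    (hg : GSet.toMap φ x = g • y) :
    entry φ x y ≫ entry ψ y z = entry (φ ≫ ψ) x z := by
  have hc : GSet.toMap (φ ≫ ψ) x = g • GSet.toMap ψ y := by
    rw [GSet.toMap_comp, hg, map_smul]
  by_cases h : ∃ g' : G, GSet.toMap ψ y = g' • z
  · obtain ⟨g', hg'⟩ := h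
    have hgg' : GSet.toMap (φ ≫ ψ) x = (g * g') • z := by rw [hc, hg', mul_smul]
    rw [entry_eq φ hg, entry_eq ψ hg', entry_eq _ hgg']
    exact Subtype.ext ((BisetGroup.compHom_cls _ _).trans (BisetGroup.cls_eq twist_comp))
  · rw [entry_eq_zero ψ h, Limits.comp_zero, entry_eq_zero]
    rintro ⟨a, ha⟩
    refine h ⟨g⁻¹ * a, ?_⟩
    rw [mul_smul, ← ha, hc, inv_smul_smul]

/-- The object of `𝐁_•(G)` given by the isotropy groups of the base points. -/
def jObj (P : PtGSet G) : ConjBurnsideAdd G where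
  ι := Fin P.n
  X i := stab (P.base i)

/-- The covariant functor `j_•` on morphisms: the matrix of the restrictions to orbits. -/
def jPush {P Q : PtGSet G} (φ : P ⟶ Q) : jObj P ⟶ jObj Q :=
  fun i k => entry ((PtGSet.forget G).map φ) (P.base i) (Q.base k)

lemma jPush_id (P : PtGSet G) : jPush (𝟙 P) = 𝟙 (jObj P) := by
  refine Mat_.hom_ext _ _ fun i k => ?_
  change entry (𝟙 P.toGSet) (P.base i) (P.base k) = _
  by_cases h : i = k
  · subst h
    rw [Mat_.id_apply_self]
    exact entry_id _
  · rw [Mat_.id_apply_of_ne _ _ _ h]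
    exact entry_eq_zero _ fun ⟨g, hg⟩ => h (P.base_unique hg)

lemma jPush_comp {P Q R : PtGSet G} (φ : P ⟶ Q) (ψ : Q ⟶ R) :
    jPush (φ ≫ ψ) = jPush φ ≫ jPush ψ := by
  refine Mat_.hom_ext _ _ fun i l => ?_
  rw [Mat_.comp_apply]
  obtain ⟨k, ⟨g, hg⟩, hk⟩ := Q.existsUnique_base
    (GSet.toMap ((PtGSet.forget G).map φ) (P.base i))
  rw [Finset.sum_eq_single (show (jObj Q).ι from k)]
  · exact (entry_comp ((PtGSet.forget G).map φ) ((PtGSet.forget G).map ψ) _ hg.symm).symm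
  · intro k' _ hk'
    have : jPush φ i k' = 0 := entry_eq_zero ((PtGSet.forget G).map φ)
      fun ⟨g', hg'⟩ => hk' (hk k' ⟨g', hg'.symm⟩)
    rw [this, Limits.zero_comp]
  · intro h
    exact absurd (Finset.mem_univ _) h

variable (G) in
/-- The bivariant functor `(j^•, j_•)` from `𝒟_*(G)` to `𝐁_•(G)`, where `j^• = τ_• ∘ j_•`. -/
def jPointed : BivariantFunctor (PtGSet G) (ConjBurnsideAdd G) where
  obj := jObj
  push := jPush
  pull φ := conjTranspose (jPush φ)
  push_id := jPush_id
  push_comp := jPush_comp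
  pull_id P := by rw [jPush_id, conjTranspose_id]
  pull_comp f g := by rw [jPush_comp, conjTranspose_comp]

/-- The bivariant functor `j` from `𝒟(G)` to `𝐁_•(G)`, depending on a choice of base points
`μ' : 𝒟(G) → 𝒟_*(G)`. -/
def j (μ' : GSet G ⥤ PtGSet G) : BivariantFunctor (GSet G) (ConjBurnsideAdd G) :=
  (jPointed G).precomp μ'

end j

end MackeyBiset

end

/-!
The bivariant functor `j` already satisfies the Mackey axioms in `𝐁_•(G)`, in the form of identities
between matrices, and every additive functor preserves these identities.

For base points `x`, `y` of `X`, `Y`, both kinds of mixed composites have as entries classes of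
honest bisets with a description free of base points.
* For a cospan `ψ : X → T ← Y : φ`, the entry of `j_•(ψ)` followed by `j^•(φ)` is the class of
  `{g : G | g ψ(x) = φ(y)}` (`jPush_comp_conjTranspose_jPush`): at most one orbit of `T` contributes
  to the matrix product.
* For a span `Φ : S → X`, `Ψ : S → Y`, the entry of `j^•(Φ)` followed by `j_•(Ψ)` is the class of
  `{(g, s) | Φ(s) = g x, Ψ(s) = y}` (`conjTranspose_jPush_comp_jPush`): the summand of a base point
  `m` of `S` is the part where `s` lies in the orbit of `m` (`twist_comp_transpose_twist`).

In a pull-back square `(g, s) ↦ g` is a bijection between these two bisets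
(`spanBiset_equiv_cospanBiset`), which is the double coset formula (M1). The biset of a span on a
disjoint union is the disjoint union of the bisets of its restrictions (`sum_spanBiset`). Hence for
the two embeddings into `S₁ ⊔ S₂` the endomorphisms `j^•` followed by `j_•` add up to the identity,
while `j_•` followed by `j^•` is the identity by (M1). This exhibits `j(S₁ ⊔ S₂)` as a biproduct and
gives (M2).
-/

namespace MackeyBiset

/-! ### Decomposing a biset into invariant parts -/

namespace Biset

variable {K H : Type u} [Group K] [Group H]

/-- The sub-biset of the points satisfying a predicate that is invariant under both actions. -/
def restrict (X : Biset K H) (p : X → Prop) (hl : ∀ (k : K) x, p x → p (k • x))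
    (hr : ∀ x (h : H), p x → p (rsmul x h)) : Biset K H where
  carrier := {x : X // p x}
  left :=
    { smul := fun k x => ⟨k • x.1, hl k _ x.2⟩
      one_smul := fun x => Subtype.ext (one_smul K x.1)
      mul_smul := fun a b x => Subtype.ext (mul_smul a b x.1) }
  right :=
    { smul := fun h x => ⟨h • x.1, hr _ h.unop x.2⟩
      one_smul := fun x => Subtype.ext (one_smul Hᵐᵒᵖ x.1)
      mul_smul := fun a b x => Subtype.ext (mul_smul a b x.1) }
  comm := @SMulCommClass.mk _ _ _ (_) (_) fun k h x => Subtype.ext (smul_comm k h x.1)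
  left_free k x e := X.left_free k x.1 (congrArg Subtype.val e)
  right_free h x e := X.right_free h x.1 (congrArg Subtype.val e)

/-- The part of `X` on which an invariant function `c` takes values in `s`. -/
def fiberOn {ι : Type v} (X : Biset K H) (c : X → ι) (hl : ∀ (k : K) x, c (k • x) = c x)
    (hr : ∀ x (h : H), c (rsmul x h) = c x) (s : Set ι) : Biset K H :=
  X.restrict (fun x => c x ∈ s) (fun _ _ hx => by rwa [hl]) (fun _ _ hx => by rwa [hr])

variable {ι : Type v} (X : Biset K H) (c : X → ι) (hl : ∀ (k : K) x, c (k • x) = c x)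
  (hr : ∀ x (h : H), c (rsmul x h) = c x)

lemma fiberOn_univ : fiberOn X c hl hr Set.univ ≈ X :=
  equiv_of_bijective (X := fiberOn X c hl hr Set.univ) (fun x : {x : X // c x ∈ Set.univ} => x.1)
    ⟨Subtype.val_injective, fun x => ⟨⟨x, trivial⟩, rfl⟩⟩ (fun _ _ => rfl) (fun _ _ => rfl)

lemma fiberOn_union {s t : Set ι} (hst : Disjoint s t) :
    sum (fiberOn X c hl hr s) (fiberOn X c hl hr t) ≈ fiberOn X c hl hr (s ∪ t) := by
  refine equiv_of_bijective (X := sum (fiberOn X c hl hr s) (fiberOn X c hl hr t))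
    (Y := fiberOn X c hl hr (s ∪ t))
    (Sum.elim (fun x : {x : X // c x ∈ s} => ⟨x.1, Or.inl x.2⟩)
      (fun x : {x : X // c x ∈ t} => ⟨x.1, Or.inr x.2⟩)) ⟨?_, ?_⟩ ?_ ?_
  · rintro (⟨a, ha⟩ | ⟨a, ha⟩) (⟨b, hb⟩ | ⟨b, hb⟩) h <;>
      obtain rfl : a = b := congrArg Subtype.val h
    · rfl
    · exact (Set.disjoint_left.1 hst ha hb).elim
    · exact (Set.disjoint_left.1 hst hb ha).elim
    · rfl
  · rintro ⟨x, hx | hx⟩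
    · exact ⟨Sum.inl ⟨x, hx⟩, rfl⟩
    · exact ⟨Sum.inr ⟨x, hx⟩, rfl⟩
  · rintro k (x | x) <;> rfl
  · rintro (x | x) h <;> rfl

/-- A biset is, in the Grothendieck group, the sum of the fibres of an invariant function. -/
lemma cls_eq_sum_fiberOn [Fintype ι] :
    BisetGroup.cls X = ∑ i, BisetGroup.cls (fiberOn X c hl hr {i}) := by
  classical
  have key (s : Finset ι) : BisetGroup.cls (fiberOn X c hl hr (s : Set ι)) =
      ∑ i ∈ s, BisetGroup.cls (fiberOn X c hl hr {i}) := by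
    induction s using Finset.induction_on with
    | empty =>
      have : IsEmpty (fiberOn X c hl hr ((∅ : Finset ι) : Set ι)) :=
        ⟨fun x => Finset.notMem_empty _
          (Subtype.prop (p := fun x => c x ∈ ((∅ : Finset ι) : Set ι)) x)⟩
      rw [BisetGroup.cls_eq (equiv_empty _), BisetGroup.cls_empty, Finset.sum_empty]
    | insert a s ha ih =>
      rw [Finset.sum_insert ha, ← ih, ← BisetGroup.cls_sum, Finset.coe_insert,
        Set.insert_eq]
      exact (BisetGroup.cls_eq (fiberOn_union X c hl hr
        (Set.disjoint_singleton_left.2 (by simpa using ha)))).symm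
  rw [← key, Finset.coe_univ, BisetGroup.cls_eq (fiberOn_univ X c hl hr)]

end Biset

/-! ### The bisets of spans and cospans of `G`-sets -/

section Span

variable {G : Type u} [Group G] [Finite G]

open MulAction

/-- For a cospan `X → T ← Y` of `G`-sets and points `x : X`, `y : Y`, the set of all `g : G` with
`g • ψ x = φ y`, on which the isotropy groups of `y` and `x` act by multiplication. -/
def cospanBiset {X Y T : GSet G} (ψ : X ⟶ T) (φ : Y ⟶ T) (x : X) (y : Y) :
    Biset (stabilizer G y) (stabilizer G x) where
  carrier := {g : G // g • GSet.toMap ψ x = GSet.toMap φ y}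
  left :=
    { smul := fun k g => ⟨k * g.1, by rw [mul_smul, g.2, ← map_smul, k.2]⟩
      one_smul := fun g => Subtype.ext (one_mul g.1)
      mul_smul := fun a b g => Subtype.ext (mul_assoc (a : G) b g.1) }
  right :=
    { smul := fun h g => ⟨g.1 * h.unop, by rw [mul_smul, ← map_smul, h.unop.2, g.2]⟩
      one_smul := fun g => Subtype.ext (mul_one g.1)
      mul_smul := fun a b g => Subtype.ext (mul_assoc g.1 (b.unop : G) a.unop).symm }
  comm := @SMulCommClass.mk _ _ _ (_) (_) fun k h g =>
    Subtype.ext (mul_assoc (k : G) g.1 h.unop).symm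
  left_free k g e := Subtype.ext (mul_eq_right.1 (congrArg Subtype.val e : (k : G) * g.1 = g.1))
  right_free h g e := Subtype.ext (mul_eq_left.1 (congrArg Subtype.val e : g.1 * (h : G) = g.1))

/-- For a span `X ← S → Y` of `G`-sets and points `x : X`, `y : Y`, the set of all pairs `(g, s)`
such that `s` maps to `g • x` in `X` and to `y` in `Y`. The actions are `k (g, s) h = (k g h, k s)`.
-/
def spanBiset {S X Y : GSet G} (Φ : S ⟶ X) (Ψ : S ⟶ Y) (x : X) (y : Y) :
    Biset (stabilizer G y) (stabilizer G x) where
  carrier := {p : G × S // GSet.toMap Φ p.2 = p.1 • x ∧ GSet.toMap Ψ p.2 = y}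
  left :=
    { smul := fun k p => ⟨(k * p.1.1, (k : G) • p.1.2), by
        rw [map_smul, p.2.1, mul_smul], by rw [map_smul, p.2.2, k.2]⟩
      one_smul := fun p => Subtype.ext (Prod.ext (one_mul p.1.1) (one_smul G p.1.2))
      mul_smul := fun a b p => Subtype.ext
        (Prod.ext (mul_assoc (a : G) b p.1.1) (mul_smul (a : G) b p.1.2)) }
  right :=
    { smul := fun h p => ⟨(p.1.1 * h.unop, p.1.2), by
        rw [mul_smul, h.unop.2, p.2.1], p.2.2⟩
      one_smul := fun p => Subtype.ext (Prod.ext (mul_one p.1.1) rfl)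
      mul_smul := fun a b p => Subtype.ext
        (Prod.ext (mul_assoc p.1.1 (b.unop : G) a.unop).symm rfl) }
  comm := @SMulCommClass.mk _ _ _ (_) (_) fun k h p =>
    Subtype.ext (Prod.ext (mul_assoc (k : G) p.1.1 h.unop).symm rfl)
  left_free k p e := Subtype.ext (mul_eq_right.1
    (congrArg (fun q => q.1.1) e : (k : G) * p.1.1 = p.1.1))
  right_free h p e := Subtype.ext (mul_eq_left.1
    (congrArg (fun q => q.1.1) e : p.1.1 * (h : G) = p.1.1))

/-- In a pull-back square, `s` is determined by `g` in a pair `(g, s)` of the span biset, so the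
projection to `g` identifies it with the cospan biset. -/
lemma spanBiset_equiv_cospanBiset {S X Y T : GSet G} {Φ : S ⟶ X} {Ψ : S ⟶ Y} {ψ : X ⟶ T}
    {φ : Y ⟶ T} (w : Ψ ≫ φ = Φ ≫ ψ)
    (hS : ∀ x y, GSet.toMap φ y = GSet.toMap ψ x →
      ∃! s, GSet.toMap Ψ s = y ∧ GSet.toMap Φ s = x) (x : X) (y : Y) :
    spanBiset Φ Ψ x y ≈ cospanBiset ψ φ x y := by
  have w' (s : S) : GSet.toMap φ (GSet.toMap Ψ s) = GSet.toMap ψ (GSet.toMap Φ s) := by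
    rw [← GSet.toMap_comp, w, GSet.toMap_comp]
  refine Biset.equiv_of_bijective (X := spanBiset Φ Ψ x y) (Y := cospanBiset ψ φ x y)
    (fun p => ⟨p.1.1, by rw [← map_smul, ← p.2.1, ← w', p.2.2]⟩) ⟨?_, ?_⟩
    (fun _ _ => rfl) (fun _ _ => rfl)
  · rintro ⟨⟨g, s⟩, h₁, h₂⟩ ⟨⟨g', s'⟩, h₁', h₂'⟩ h
    obtain rfl : g = g' := congrArg Subtype.val h
    have e : GSet.toMap φ y = GSet.toMap ψ (g • x) := by rw [← h₁, ← h₂, w']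
    obtain rfl : s = s' := (hS _ _ e).unique ⟨h₂, h₁⟩ ⟨h₂', h₁'⟩
    rfl
  · rintro ⟨g, hg⟩
    obtain ⟨s, ⟨h₁, h₂⟩, -⟩ := hS (g • x) y (by rw [map_smul, hg])
    exact ⟨⟨(g, s), h₂, h₁⟩, rfl⟩

/-- If `S` is the disjoint union of `S₁` and `S₂`, then the biset of a span on `S` is the disjoint
union of the bisets of its restrictions. -/
lemma sum_spanBiset {S₁ S₂ S X Y : GSet G} (f : S₁ ⟶ S) (g : S₂ ⟶ S)
    (h : Function.Bijective (Sum.elim (GSet.toMap f) (GSet.toMap g)))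
    (Φ : S ⟶ X) (Ψ : S ⟶ Y) (x : X) (y : Y) :
    Biset.sum (spanBiset (f ≫ Φ) (f ≫ Ψ) x y) (spanBiset (g ≫ Φ) (g ≫ Ψ) x y) ≈
      spanBiset Φ Ψ x y := by
  refine Biset.equiv_of_bijective
    (X := Biset.sum (spanBiset (f ≫ Φ) (f ≫ Ψ) x y) (spanBiset (g ≫ Φ) (g ≫ Ψ) x y))
    (Y := spanBiset Φ Ψ x y)
    (Sum.elim (fun p => ⟨(p.1.1, GSet.toMap f p.1.2), p.2⟩)
      (fun p => ⟨(p.1.1, GSet.toMap g p.1.2), p.2⟩)) ⟨?_, ?_⟩ ?_ ?_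
  · rintro (⟨⟨a, s⟩, hs⟩ | ⟨⟨a, s⟩, hs⟩) (⟨⟨b, t⟩, ht⟩ | ⟨⟨b, t⟩, ht⟩) e
    · obtain rfl : a = b := congrArg (fun q => q.1.1) e
      obtain rfl : s = t := Sum.inl_injective
        (h.1 (a₁ := Sum.inl s) (a₂ := Sum.inl t) (congrArg (fun q => q.1.2) e))
      rfl
    · cases h.1 (a₁ := Sum.inl s) (a₂ := Sum.inr t) (congrArg (fun q => q.1.2) e)
    · cases h.1 (a₁ := Sum.inr s) (a₂ := Sum.inl t) (congrArg (fun q => q.1.2) e)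
    · obtain rfl : a = b := congrArg (fun q => q.1.1) e
      obtain rfl : s = t := Sum.inr_injective
        (h.1 (a₁ := Sum.inr s) (a₂ := Sum.inr t) (congrArg (fun q => q.1.2) e))
      rfl
  · rintro ⟨⟨a, s⟩, hs⟩
    obtain ⟨t | t, rfl⟩ := h.2 s
    · exact ⟨Sum.inl ⟨(a, t), hs⟩, rfl⟩
    · exact ⟨Sum.inr ⟨(a, t), hs⟩, rfl⟩
  · rintro k (p | p)
    · exact Subtype.ext (Prod.ext rfl (map_smul (GSet.toMap f) (k : G) p.1.2))
    · exact Subtype.ext (Prod.ext rfl (map_smul (GSet.toMap g) (k : G) p.1.2))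
  · rintro (p | p) h <;> rfl

/-- The biset `L ×_L L` of a cospan of orbits with common target `G/L`: `(l', l)` corresponds to
`b l'⁻¹ l a⁻¹`. -/
lemma transpose_twist_comp_twist {X Y T : GSet G} (ψ : X ⟶ T) (φ : Y ⟶ T) {x : X} {y : Y} {t : T}
    {a b : G} (ha : GSet.toMap ψ x = a • t) (hb : GSet.toMap φ y = b • t) :
    Biset.comp (Biset.transpose (twist _ _ b (conj_mem_stabilizer φ hb)))
      (twist _ _ a (conj_mem_stabilizer ψ ha)) ≈ cospanBiset ψ φ x y := by
  refine Biset.equiv_of_bijective (Y := cospanBiset ψ φ x y)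
    (Biset.compLift (Z := cospanBiset ψ φ x y)
      (fun (l' : stabilizer G t) (l : stabilizer G t) => ⟨b * (l' : G)⁻¹ * l * a⁻¹, ?_⟩) ?_)
    ⟨?_, ?_⟩ ?_ ?_
  · have h₁ : (l : G) • t = t := l.2
    have h₂ : (l' : G)⁻¹ • t = t := (l'⁻¹).2
    rw [ha, hb, mul_smul, inv_smul_smul, mul_smul, h₁, mul_smul, h₂]
  · intro (l' : stabilizer G t) m (l : stabilizer G t)
    refine Subtype.ext ?_
    change b * ((m : G)⁻¹ * l')⁻¹ * l * a⁻¹ = b * (l' : G)⁻¹ * (m * l) * a⁻¹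
    group
  · intro p q e
    obtain ⟨l', l, rfl⟩ := Biset.pair_surj p
    obtain ⟨k', k, rfl⟩ := Biset.pair_surj q
    change stabilizer G t at l' l k' k
    have e' : b * (l' : G)⁻¹ * l * a⁻¹ = b * (k' : G)⁻¹ * k * a⁻¹ := congrArg Subtype.val e
    have e'' : (l' : G)⁻¹ * l = (k' : G)⁻¹ * k := mul_left_cancel (a := b) (by
      simpa only [mul_assoc] using mul_right_cancel e')
    refine Biset.pair_eq_iff.2 ⟨l * k⁻¹, Subtype.ext ?_, Subtype.ext ?_⟩
    · change (k' : G) = ((l : G) * (k : G)⁻¹)⁻¹ * l'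
      have hk : (k : G) = k' * ((l' : G)⁻¹ * l) := by rw [e'', mul_inv_cancel_left]
      rw [hk]
      group
    · exact (inv_mul_cancel_right (l : G) k).symm
  · rintro ⟨g, hg⟩
    have hm : b⁻¹ * g * a ∈ stabilizer G t := by
      rw [mem_stabilizer_iff, mul_smul, ← ha, mul_smul, hg, hb, inv_smul_smul]
    refine ⟨Biset.pair (X := Biset.transpose (twist _ _ b (conj_mem_stabilizer φ hb)))
      (Y := twist _ _ a (conj_mem_stabilizer ψ ha)) (1 : stabilizer G t)
      (⟨_, hm⟩ : stabilizer G t), Subtype.ext ?_⟩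
    change b * (1 : G)⁻¹ * (b⁻¹ * g * a) * a⁻¹ = g
    group
  · intro k p
    obtain ⟨l', l, rfl⟩ := Biset.pair_surj p
    change stabilizer G t at l' l
    refine Subtype.ext ?_
    change b * ((l' : G) * (b⁻¹ * (k : G)⁻¹ * b))⁻¹ * l * a⁻¹ = k * (b * (l' : G)⁻¹ * l * a⁻¹)
    group
  · intro p h
    obtain ⟨l', l, rfl⟩ := Biset.pair_surj p
    change stabilizer G t at l' l
    refine Subtype.ext ?_
    change b * (l' : G)⁻¹ * (l * (a⁻¹ * h * a)) * a⁻¹ = b * (l' : G)⁻¹ * l * a⁻¹ * h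
    group

end Span

/-! ### Orbits of base points -/

namespace PtGSet

variable {G : Type u} [Group G]

/-- The index of the base point in the orbit of `x`. -/
noncomputable def orbitIndex (P : PtGSet G) (x : P.toGSet) : Fin P.n :=
  (P.existsUnique_base x).choose

lemma orbitIndex_eq_iff (P : PtGSet G) {x : P.toGSet} {i : Fin P.n} :
    P.orbitIndex x = i ↔ ∃ u : G, x = u • P.base i := by
  constructor
  · rintro rfl
    obtain ⟨u, hu⟩ := (P.existsUnique_base x).choose_spec.1
    exact ⟨u, hu.symm⟩
  · rintro ⟨u, hu⟩
    exact ((P.existsUnique_base x).choose_spec.2 i ⟨u, hu.symm⟩).symm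

lemma orbitIndex_smul (P : PtGSet G) (g : G) (x : P.toGSet) :
    P.orbitIndex (g • x) = P.orbitIndex x := by
  obtain ⟨u, hu⟩ := P.orbitIndex_eq_iff.1 (rfl : P.orbitIndex x = _)
  exact P.orbitIndex_eq_iff.2 ⟨g * u, by rw [mul_smul, ← hu]⟩

end PtGSet

/-! ### The orbit decomposition of the biset of a span -/

section OrbitSpan
variable {G : Type u} [Group G] [Finite G]

open MulAction

/-- The part of the biset of a span `X ← S → Y` lying over the orbit of the `m`-th base point of
`S`. -/
noncomputable def orbitSpanBiset (P : PtGSet G) {X Y : GSet G} (Φ : P.toGSet ⟶ X)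
    (Ψ : P.toGSet ⟶ Y) (x : X) (y : Y) (m : Fin P.n) : Biset (stabilizer G y) (stabilizer G x) :=
  (spanBiset Φ Ψ x y).fiberOn (fun p => P.orbitIndex p.1.2)
    (fun k p => P.orbitIndex_smul (k : G) p.1.2) (fun _ _ => rfl) {m}

/-- The biset `K ×_M H` of a span of orbits: `(k, h)` corresponds to
`(k b⁻¹ a h⁻¹, k b⁻¹ s)`. -/
lemma twist_comp_transpose_twist (P : PtGSet G) {X Y : GSet G} (Φ : P.toGSet ⟶ X)
    (Ψ : P.toGSet ⟶ Y) {x : X} {y : Y} {m : Fin P.n} {a b : G}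
    (ha : GSet.toMap Φ (P.base m) = a • x) (hb : GSet.toMap Ψ (P.base m) = b • y) :
    Biset.comp (twist _ _ b (conj_mem_stabilizer Ψ hb))
      (Biset.transpose (twist _ _ a (conj_mem_stabilizer Φ ha))) ≈
      orbitSpanBiset P Φ Ψ x y m := by
  refine Biset.equiv_of_bijective (Y := orbitSpanBiset P Φ Ψ x y m)
    (Biset.compLift (Z := orbitSpanBiset P Φ Ψ x y m)
      (fun (k : stabilizer G y) (h : stabilizer G x) =>
        ⟨⟨(k * b⁻¹ * a * (h : G)⁻¹, (k * b⁻¹ : G) • P.base m), ?_, ?_⟩, ?_⟩) ?_)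
    ⟨?_, ?_⟩ ?_ ?_
  · have h₁ : (h : G)⁻¹ • x = x := (h⁻¹).2
    rw [map_smul, ha, mul_smul _ (h : G)⁻¹, h₁, mul_smul _ a]
  · have h₁ : (k : G) • y = y := k.2
    rw [map_smul, hb, mul_smul, inv_smul_smul, h₁]
  · exact P.orbitIndex_eq_iff.2 ⟨_, rfl⟩
  · intro (k : stabilizer G y) n (h : stabilizer G x)
    have hn : (n : G) • P.base m = P.base m := n.2
    refine Subtype.ext (Subtype.ext (Prod.ext ?_ ?_))
    · change (k : G) * (b⁻¹ * n * b) * b⁻¹ * a * (h : G)⁻¹ =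
        k * b⁻¹ * a * ((h : G) * (a⁻¹ * (n : G)⁻¹ * a))⁻¹
      group
    · change ((k : G) * (b⁻¹ * n * b) * b⁻¹) • P.base m = (k * b⁻¹ : G) • P.base m
      conv_rhs => rw [← hn, ← mul_smul]
      congr 1
      group
  · intro p q e
    obtain ⟨k, h, rfl⟩ := Biset.pair_surj p
    obtain ⟨k', h', rfl⟩ := Biset.pair_surj q
    change stabilizer G y at k k'
    change stabilizer G x at h h'
    have e₁ : (k : G) * b⁻¹ * a * (h : G)⁻¹ = k' * b⁻¹ * a * (h' : G)⁻¹ :=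
      congrArg (fun z => z.1.1.1) e
    have e₂ : (k * b⁻¹ : G) • P.base m = (k' * b⁻¹ : G) • P.base m :=
      congrArg (fun z => z.1.1.2) e
    have hn : b * (k : G)⁻¹ * k' * b⁻¹ ∈ stabilizer G (P.base m) := by
      rw [mem_stabilizer_iff, mul_assoc, mul_smul, ← e₂, ← mul_smul]
      simp
    refine Biset.pair_eq_iff.2 ⟨⟨_, hn⟩, Subtype.ext ?_, Subtype.ext ?_⟩
    · change (k' : G) = k * (b⁻¹ * (b * (k : G)⁻¹ * k' * b⁻¹) * b)
      group
    · change (h : G) = h' * (a⁻¹ * (b * (k : G)⁻¹ * k' * b⁻¹)⁻¹ * a)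
      have e₃ : (h : G)⁻¹ = a⁻¹ * b * (k : G)⁻¹ * (k' * b⁻¹ * a * (h' : G)⁻¹) := by
        rw [← e₁]
        group
      rw [← inv_inv (h : G), e₃]
      group
  · rintro ⟨⟨⟨g, s⟩, h₁, h₂⟩, hs⟩
    obtain ⟨v, rfl⟩ := P.orbitIndex_eq_iff.1 hs
    have hk : v * b ∈ stabilizer G y := by
      rw [mem_stabilizer_iff, mul_smul, ← hb, ← map_smul]
      exact h₂
    have hh : g⁻¹ * v * a ∈ stabilizer G x := by
      rw [mem_stabilizer_iff, mul_smul, ← ha, mul_smul, ← map_smul, inv_smul_eq_iff]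
      exact h₁
    refine ⟨Biset.pair (X := twist _ _ b (conj_mem_stabilizer Ψ hb))
      (Y := Biset.transpose (twist _ _ a (conj_mem_stabilizer Φ ha)))
      (⟨_, hk⟩ : stabilizer G y) (⟨_, hh⟩ : stabilizer G x),
      Subtype.ext (Subtype.ext (Prod.ext ?_ ?_))⟩
    · change v * b * b⁻¹ * a * (g⁻¹ * v * a)⁻¹ = g
      group
    · change (v * b * b⁻¹) • P.base m = v • P.base m
      rw [mul_inv_cancel_right]
  · intro l p
    obtain ⟨k, h, rfl⟩ := Biset.pair_surj p
    change stabilizer G y at k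
    change stabilizer G x at h
    refine Subtype.ext (Subtype.ext (Prod.ext ?_ ?_))
    · change (l : G) * k * b⁻¹ * a * (h : G)⁻¹ = l * (k * b⁻¹ * a * (h : G)⁻¹)
      group
    · change ((l : G) * k * b⁻¹) • P.base m = (l : G) • (k * b⁻¹ : G) • P.base m
      rw [← mul_smul, mul_assoc]
  · intro p l
    obtain ⟨k, h, rfl⟩ := Biset.pair_surj p
    change stabilizer G y at k
    change stabilizer G x at h
    refine Subtype.ext (Subtype.ext (Prod.ext ?_ rfl))
    change (k : G) * b⁻¹ * a * ((l : G)⁻¹ * h)⁻¹ = k * b⁻¹ * a * (h : G)⁻¹ * l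
    group

/-! ### The matrices of spans and cospans -/

lemma entry_comp_tauB_entry {X Y T : GSet G} (ψ : X ⟶ T) (φ : Y ⟶ T) {x : X} {y : Y} {t : T}
    {a b : G} (ha : GSet.toMap ψ x = a • t) (hb : GSet.toMap φ y = b • t) :
    (conjInclusion G).map (entry ψ x t ≫ tauB (entry φ y t)) =
      BisetGroup.cls (cospanBiset ψ φ x y) := by
  rw [entry_eq ψ ha, entry_eq φ hb, ← BisetGroup.cls_eq (transpose_twist_comp_twist ψ φ ha hb),
    ← BisetGroup.compHom_cls, ← BisetGroup.tau_cls]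
  rfl

lemma tauB_entry_comp_entry (P : PtGSet G) {X Y : GSet G} (Φ : P.toGSet ⟶ X) (Ψ : P.toGSet ⟶ Y)
    (x : X) (y : Y) (m : Fin P.n) :
    (conjInclusion G).map (tauB (entry Φ (P.base m) x) ≫ entry Ψ (P.base m) y) =
      BisetGroup.cls (orbitSpanBiset P Φ Ψ x y m) := by
  by_cases h : (∃ a : G, GSet.toMap Φ (P.base m) = a • x) ∧
      ∃ b : G, GSet.toMap Ψ (P.base m) = b • y
  · obtain ⟨⟨a, ha⟩, b, hb⟩ := h
    rw [entry_eq Φ ha, entry_eq Ψ hb,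
      ← BisetGroup.cls_eq (twist_comp_transpose_twist P Φ Ψ ha hb),
      ← BisetGroup.compHom_cls, ← BisetGroup.tau_cls]
    rfl
  · have h0 : tauB (entry Φ (P.base m) x) ≫ entry Ψ (P.base m) y = 0 := by
      rcases not_and_or.1 h with h | h
      · rw [entry_eq_zero Φ h, map_zero, Limits.zero_comp]
      · rw [entry_eq_zero Ψ h, Limits.comp_zero]
    have : IsEmpty (orbitSpanBiset P Φ Ψ x y m) := ⟨by
      rintro ⟨⟨⟨g, s⟩, h₁, h₂⟩, hs⟩
      obtain ⟨v, rfl⟩ := P.orbitIndex_eq_iff.1 hs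
      refine h ⟨⟨v⁻¹ * g, ?_⟩, v⁻¹, ?_⟩
      · rw [mul_smul, ← h₁, map_smul, inv_smul_smul]
      · rw [← h₂, map_smul, inv_smul_smul]⟩
    rw [h0, Functor.map_zero, BisetGroup.cls_eq (Biset.equiv_empty _), BisetGroup.cls_empty]
    rfl

/-- The entries of `j_•(ψ)` followed by `j^•(φ)` are the classes of the cospan bisets. -/
lemma jPush_comp_conjTranspose_jPush {P Q R : PtGSet G} (ψ : P ⟶ R) (φ : Q ⟶ R)
    (i : Fin P.n) (k : Fin Q.n) :
    (conjInclusion G).map ((jPush ψ ≫ conjTranspose (jPush φ)) i k) =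
      BisetGroup.cls (cospanBiset ((PtGSet.forget G).map ψ) ((PtGSet.forget G).map φ)
        (P.base i) (Q.base k)) := by
  refine (congrArg _ (Mat_.comp_apply _ _ _ _)).trans ?_
  set ψ' := (PtGSet.forget G).map ψ
  set φ' := (PtGSet.forget G).map φ
  -- Only the base point in the orbit of `ψ x` contributes to the matrix product.
  obtain ⟨a, ha⟩ := R.orbitIndex_eq_iff.1 (rfl : R.orbitIndex (GSet.toMap ψ' (P.base i)) = _)
  rw [Finset.sum_eq_single (show (jObj R).ι from R.orbitIndex (GSet.toMap ψ' (P.base i)))]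
  · by_cases hb : ∃ b : G, GSet.toMap φ' (Q.base k) =
        b • R.base (R.orbitIndex (GSet.toMap ψ' (P.base i)))
    · obtain ⟨b, hb⟩ := hb
      exact entry_comp_tauB_entry ψ' φ' ha hb
    · have h0 : conjTranspose (jPush φ) (show (jObj R).ι from
          R.orbitIndex (GSet.toMap ψ' (P.base i))) k = 0 :=
        (congrArg tauB (entry_eq_zero φ' hb)).trans (map_zero _)
      have : IsEmpty (cospanBiset ψ' φ' (P.base i) (Q.base k)) := ⟨by
        rintro ⟨g, hg⟩
        exact hb ⟨g * a, hg.symm.trans ((congrArg (g • ·) ha).trans (mul_smul _ _ _).symm)⟩⟩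
      rw [h0, Limits.comp_zero, Functor.map_zero, BisetGroup.cls_eq (Biset.equiv_empty _),
        BisetGroup.cls_empty]
      rfl
  · intro l _ hl
    have h0 : jPush ψ i l = 0 := entry_eq_zero ψ' fun ⟨g, hg⟩ =>
      hl (R.orbitIndex_eq_iff.2 ⟨g, hg⟩).symm
    rw [h0, Limits.zero_comp]
  · exact fun h => absurd (Finset.mem_univ _) h

/-- The entries of `j^•(Φ)` followed by `j_•(Ψ)` are the classes of the span bisets. -/
lemma conjTranspose_jPush_comp_jPush {P Q S : PtGSet G} (Φ : S ⟶ P) (Ψ : S ⟶ Q)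
    (i : Fin P.n) (k : Fin Q.n) :
    (conjInclusion G).map ((conjTranspose (jPush Φ) ≫ jPush Ψ) i k) =
      BisetGroup.cls (spanBiset ((PtGSet.forget G).map Φ) ((PtGSet.forget G).map Ψ)
        (P.base i) (Q.base k)) := by
  refine (congrArg _ (Mat_.comp_apply _ _ _ _)).trans ?_
  refine (Functor.map_sum _ _ _).trans (Eq.trans ?_ (Biset.cls_eq_sum_fiberOn
    (spanBiset ((PtGSet.forget G).map Φ) ((PtGSet.forget G).map Ψ) (P.base i) (Q.base k))
    (fun p => S.orbitIndex p.1.2) (fun k p => S.orbitIndex_smul (k : G) p.1.2)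
    (fun _ _ => rfl)).symm)
  exact Finset.sum_congr rfl fun m _ => tauB_entry_comp_entry S _ _ _ _ m

lemma conjInclusion_map_injective {H K : ConjBurnside G} {f g : H ⟶ K}
    (h : (conjInclusion G).map f = (conjInclusion G).map g) : f = g := Subtype.ext h

/-- The pull-back formula for `j`: both sides have the class of the same biset as entries. -/
lemma jPush_comp_conjTranspose_of_pullback {P Q R S : PtGSet G} {Φ : S ⟶ P} {Ψ : S ⟶ Q}
    {ψ : P ⟶ R} {φ : Q ⟶ R} (w : Ψ ≫ φ = Φ ≫ ψ)
    (hS : ∀ x y, GSet.toMap ((PtGSet.forget G).map φ) y = GSet.toMap ((PtGSet.forget G).map ψ) x →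
      ∃! s, GSet.toMap ((PtGSet.forget G).map Ψ) s = y ∧
        GSet.toMap ((PtGSet.forget G).map Φ) s = x) :
    jPush ψ ≫ conjTranspose (jPush φ) = conjTranspose (jPush Φ) ≫ jPush Ψ := by
  refine Mat_.hom_ext _ _ fun i k => conjInclusion_map_injective ?_
  exact (jPush_comp_conjTranspose_jPush ψ φ i k).trans
    ((BisetGroup.cls_eq (spanBiset_equiv_cospanBiset
      (congrArg (PtGSet.forget G).map w) hS _ _)).symm.trans
      (conjTranspose_jPush_comp_jPush Φ Ψ i k).symm)

lemma jPush_comp_conjTranspose_of_injective {P Q : PtGSet G} (f : P ⟶ Q)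
    (hf : Function.Injective (GSet.toMap ((PtGSet.forget G).map f))) :
    jPush f ≫ conjTranspose (jPush f) = 𝟙 (jObj P) := by
  rw [jPush_comp_conjTranspose_of_pullback (Φ := 𝟙 P) (Ψ := 𝟙 P) rfl, jPush_id, conjTranspose_id,
    Category.id_comp]
  exact fun x y h => ⟨x, ⟨(hf h).symm, rfl⟩, fun s hs => hs.2⟩

/-- If `Q` is the disjoint union of the images of two injective maps, then the corresponding
idempotents are complementary: all entries are classes of span bisets, and those of the identity
span of `Q` decompose. -/
lemma conjTranspose_comp_jPush_add {P P' Q : PtGSet G} (f : P ⟶ Q) (g : P' ⟶ Q)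
    (h : Function.Bijective (Sum.elim (GSet.toMap ((PtGSet.forget G).map f))
      (GSet.toMap ((PtGSet.forget G).map g)))) :
    conjTranspose (jPush f) ≫ jPush f + conjTranspose (jPush g) ≫ jPush g = 𝟙 (jObj Q) := by
  have h1 : 𝟙 (jObj Q) = conjTranspose (jPush (𝟙 Q)) ≫ jPush (𝟙 Q) := by
    rw [jPush_id, conjTranspose_id, Category.id_comp]
  rw [h1]
  refine Mat_.hom_ext _ _ fun i k => conjInclusion_map_injective ?_
  rw [Mat_.add_apply, Functor.map_add]
  refine Eq.trans ?_ (conjTranspose_jPush_comp_jPush (𝟙 Q) (𝟙 Q) i k).symm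
  refine Eq.trans ?_ (BisetGroup.cls_eq (sum_spanBiset _ _ h _ _ _ _))
  refine Eq.trans ?_ (BisetGroup.cls_sum _ _).symm
  exact congrArg₂ (· + ·) (conjTranspose_jPush_comp_jPush f f i k)
    (conjTranspose_jPush_comp_jPush g g i k)

end OrbitSpan

/-! ### Pull-backs of finite `G`-sets -/

section Pullback

variable {G : Type u} [Group G] [Finite G]

/-- The `G`-set `G` with left multiplication represents the functor of points. -/
abbrev GSet.regular (G : Type u) [Group G] [Finite G] : GSet G := ⟨G⟩

/-- The `G`-map `g ↦ g • x`. -/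
def GSet.point {X : GSet G} (x : X) : GSet.regular G ⟶ X :=
  ({ toFun := fun g : G => g • x, map_smul' := fun a b => mul_smul a b x } : G →[G] X)

lemma GSet.point_comp {X Y : GSet G} (x : X) (f : X ⟶ Y) :
    GSet.point x ≫ f = GSet.point (GSet.toMap f x) :=
  MulActionHom.ext fun g : G => map_smul (GSet.toMap f) g x

lemma GSet.point_injective {X : GSet G} : Function.Injective (GSet.point (X := X)) := by
  intro x y h
  have := DFunLike.congr_fun (F := G →[G] X) h (1 : G)
  change (1 : G) • x = (1 : G) • y at this
  rwa [one_smul, one_smul] at this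

lemma GSet.eq_point {X : GSet G} (f : GSet.regular G ⟶ X) :
    f = GSet.point (GSet.toMap f (1 : G)) :=
  MulActionHom.ext fun g : G => by
    change GSet.toMap f g = g • GSet.toMap f (1 : G)
    rw [← map_smul]
    exact congrArg (GSet.toMap f) (mul_one g).symm

lemma GSet.existsUnique_of_isPullback {S X Y T : GSet G} {Ψ : S ⟶ Y} {Φ : S ⟶ X} {φ : Y ⟶ T}
    {ψ : X ⟶ T} (h : IsPullback Ψ Φ φ ψ) (x : X) (y : Y)
    (e : GSet.toMap φ y = GSet.toMap ψ x) :
    ∃! s, GSet.toMap Ψ s = y ∧ GSet.toMap Φ s = x := by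
  have w : GSet.point y ≫ φ = GSet.point x ≫ ψ := by rw [point_comp, point_comp, e]
  refine ⟨GSet.toMap (h.lift _ _ w) (1 : G), ⟨?_, ?_⟩, ?_⟩
  · rw [← toMap_comp, h.lift_fst]
    exact one_smul G y
  · rw [← toMap_comp, h.lift_snd]
    exact one_smul G x
  · rintro s ⟨rfl, rfl⟩
    refine point_injective ?_
    rw [← eq_point]
    refine h.hom_ext ?_ ?_
    · rw [h.lift_fst, point_comp]
    · rw [h.lift_snd, point_comp]

end Pullback

/-! ### Additivity -/

instance {C : Type u₁} [Category.{v₁} C] [Preadditive C] {D : Type u₂} [Category.{v₁} D]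
    [Preadditive D] (F : C ⥤ D) [F.Additive] : F.mapMat_.Additive where
  map_add := Mat_.hom_ext _ _ fun _ _ => F.map_add

/-- Two split surjections whose idempotents add up to the identity decompose the source as a direct
sum: the relation forces the mixed composites `q₁ ∘ p₂` and `q₂ ∘ p₁` to vanish. -/
lemma bijective_prod_of_add_eq {A₁ A₂ B : Type*} [AddCommGroup A₁] [AddCommGroup A₂]
    [AddCommGroup B] {p₁ : A₁ →+ B} {p₂ : A₂ →+ B} {q₁ : B →+ A₁} {q₂ : B →+ A₂}
    (h₁ : ∀ a, q₁ (p₁ a) = a) (h₂ : ∀ a, q₂ (p₂ a) = a) (h : ∀ b, p₁ (q₁ b) + p₂ (q₂ b) = b) :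
    Function.Bijective (q₁.prod q₂) := by
  have h₁₂ (a : A₂) : q₁ (p₂ a) = 0 := by
    have := h (p₂ a)
    rw [h₂, add_eq_right] at this
    rw [← h₁ (q₁ (p₂ a)), this, map_zero]
  have h₂₁ (a : A₁) : q₂ (p₁ a) = 0 := by
    have := h (p₁ a)
    rw [h₁, add_eq_left] at this
    rw [← h₂ (q₂ (p₁ a)), this, map_zero]
  refine ⟨(injective_iff_map_eq_zero _).2 fun b hb => ?_, fun a => ⟨p₁ a.1 + p₂ a.2, ?_⟩⟩
  · obtain ⟨hb₁, hb₂⟩ := Prod.ext_iff.1 hb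
    change q₁ b = 0 at hb₁
    change q₂ b = 0 at hb₂
    rw [← h b, hb₁, hb₂, map_zero, map_zero, add_zero]
  · refine Prod.ext ?_ ?_
    · change q₁ _ = _
      rw [map_add, h₁, h₁₂, add_zero]
    · change q₂ _ = _
      rw [map_add, h₂, h₂₁, zero_add]

end MackeyBiset

theorem corollaryB {G : Type u} [Group G] [Finite G]
    (μ' : MackeyBiset.GSet G ⥤ MackeyBiset.PtGSet G) (hμ' : Nonempty (μ' ⋙ MackeyBiset.PtGSet.forget G ≅ 𝟭 (MackeyBiset.GSet G)))
    (F : MackeyBiset.BurnsideAdd G ⥤ AddCommGrpCat.{w}) [F.Additive] :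
    MackeyBiset.IsMackey ((MackeyBiset.j μ').postcomp (MackeyBiset.conjInclusionAdd G ⋙ F)) := by
  open MackeyBiset in
  obtain ⟨e⟩ := hμ'
  have hadd : (conjInclusionAdd G ⋙ F).Additive := by
    have : (conjInclusionAdd G).Additive := inferInstanceAs (conjInclusion G).mapMat_.Additive
    infer_instance
  generalize conjInclusionAdd G ⋙ F = F' at hadd
  -- Up to the natural bijection `e`, the underlying `G`-maps of `μ' f` and `f` agree.
  have hn {X Y : GSet G} (f : X ⟶ Y) (x : (μ'.obj X).toGSet) :
      GSet.toMap (e.hom.app Y) (GSet.toMap ((PtGSet.forget G).map (μ'.map f)) x) =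
        GSet.toMap f (GSet.toMap (e.hom.app X) x) :=
    DFunLike.congr_fun (F := (μ'.obj X).toGSet →[G] Y) (e.hom.naturality f) x
  have hb (X : GSet G) : Function.Bijective (GSet.toMap (e.hom.app X)) :=
    Function.bijective_iff_has_inverse.2 ⟨GSet.toMap (e.inv.app X),
      fun x => DFunLike.congr_fun (F := (μ'.obj X).toGSet →[G] (μ'.obj X).toGSet)
        (e.hom_inv_id_app X) x,
      fun x => DFunLike.congr_fun (F := X →[G] X) (e.inv_hom_id_app X) x⟩
  refine ⟨fun {S S₁ S₂ T Ψ Φ φ ψ} h => ?_, fun S₁ S₂ => ?_, fun S hS => ?_⟩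
  · change F'.map (jPush _) ≫ F'.map (conjTranspose (jPush _)) =
      F'.map (conjTranspose (jPush _)) ≫ F'.map (jPush _)
    rw [← F'.map_comp, ← F'.map_comp]
    refine congrArg _ (jPush_comp_conjTranspose_of_pullback ?_ fun x y hxy => ?_)
    · rw [← μ'.map_comp, ← μ'.map_comp, h.w]
    · obtain ⟨s, ⟨hs₁, hs₂⟩, hs⟩ := GSet.existsUnique_of_isPullback h
        (GSet.toMap (e.hom.app S₂) x) (GSet.toMap (e.hom.app S₁) y) 
        ((hn φ y).symm.trans ((congrArg _ hxy).trans (hn ψ x)))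
      obtain ⟨s, rfl⟩ := (hb S).2 s
      refine ⟨s, ⟨(hb S₁).1 ((hn Ψ s).trans hs₁), (hb S₂).1 ((hn Φ s).trans hs₂)⟩, ?_⟩
      rintro s' ⟨rfl, rfl⟩
      exact (hb S).1 (hs _ ⟨(hn Ψ s').symm, (hn Φ s').symm⟩)
  · have hl := jPush_comp_conjTranspose_of_injective (μ'.map (GSet.inl S₁ S₂)) fun x y hxy =>
      (hb S₁).1 (Sum.inl_injective ((hn _ x).symm.trans ((congrArg _ hxy).trans (hn _ y))))
    have hr := jPush_comp_conjTranspose_of_injective (μ'.map (GSet.inr S₁ S₂)) fun x y hxy =>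
      (hb S₂).1 (Sum.inr_injective ((hn _ x).symm.trans ((congrArg _ hxy).trans (hn _ y))))
    have hlr := conjTranspose_comp_jPush_add (μ'.map (GSet.inl S₁ S₂))
      (μ'.map (GSet.inr S₁ S₂)) (by
      refine ((hb (S₁.sum S₂)).of_comp_iff' _).1 ?_
      refine Eq.mpr (congrArg _ (funext ?_)) ((Equiv.sumCongr (Equiv.ofBijective _ (hb S₁))
        (Equiv.ofBijective _ (hb S₂))).bijective)
      rintro (x | x)
      · exact hn (GSet.inl S₁ S₂) x
      · exact hn (GSet.inr S₁ S₂) x)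
    replace hl := congrArg F'.map hl
    replace hr := congrArg F'.map hr
    replace hlr := congrArg F'.map hlr
    rw [F'.map_comp, F'.map_id] at hl hr
    rw [F'.map_add, F'.map_comp, F'.map_comp, F'.map_id] at hlr
    exact bijective_prod_of_add_eq (fun a => ConcreteCategory.congr_hom hl a)
      (fun a => ConcreteCategory.congr_hom hr a) (fun b => ConcreteCategory.congr_hom hlr b)
  · -- A family of base points of the empty set is empty, so the identity matrix is zero.
    have h0 : 𝟙 (jObj (μ'.obj S)) = 0 := Mat_.hom_ext _ _ fun i _ =>
      (hS.false (GSet.toMap (e.hom.app S) ((μ'.obj S).base i))).elim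
    replace h0 := congrArg F'.map h0
    rw [F'.map_id, F'.map_zero] at h0
    exact ⟨fun a b => (ConcreteCategory.congr_hom h0 a).trans
      (ConcreteCategory.congr_hom h0 b).symm⟩
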